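/- Let $\mathbb K$ be a subfield of $\mathbb R$ and $I\subseteq\mathbb R$ an interval with $\inf I=0$. Put $W_n(\mathbb K)=\{\lambda\in\mathbb K^n:\lambda_i\ge 0,\ \sum_i\lambda_i>0\}$. A $\mathbb K$-weighted mean on $I$ is a function $\mathscr M\colon\bigcup_{n\ge1} I^n\times W_n(\mathbb K)\to I$ such that: (i) $\mathscr M(x,t\lambda)=\mathscr M(x,\lambda)$ for $t\in\mathbb K$, $t>0$; (ii) $\mathscr M(x,\lambda+\mu)=\mathscr M((x_1,x_1,\dots,x_n,x_n),(\lambda_1,\mu_1,\dots,\lambda_n,\mu_n))$ for $\lambda,\mu\in W_n(\mathbb K)$; (iii) $\min_i x_i\le\mathscr M(x,\lambda)\le\max_i x_i$; (iv) an entry of weight $0$ can be dropped together with its weight. It is symmetric if it is invariant under simultaneous permutations of entries and weights, monotone if it is nondecreasing in each entry, and continuous in entries if $\mathscr M(\cdot,\lambda)$ is continuous on $I^n$ for all $n$ and $\lambda\in W_n(\mathbb K)$. Its Hardy constant $\mathrm{Hc}(\mathscr M)$ is the smallest $C\in[0,\infty]$ (namely $\infty$ if no finite $C$ works) with $$\sum_{n=1}^\infty\lambda_n\,\mathscr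 M\big((x_1,\dots,x_n),(\lambda_1,\dots,\lambda_n)\big)\le C\sum_{n=1}^\infty\lambda_nx_n$$ for all sequences of positive elements $x_n\in I$ and $\lambda_n\in\mathbb K$. A function $g\colon[0,1)\to I$ is $\mathbb K$-simple if there are $0=s_0<s_1<\dots<s_n=1$ in $\mathbb K$ such that $g$ is constant, equal to some $y_i$, on each $[s_{i-1},s_i)$; put $\mathscr M g(x)\,dx=\mathscr M\big((y_1,\dots,y_n),(s_1-s_0,\dots,s_n-s_{n-1})\big)$. For $f\colon[0,1)\to I$ let $\mathrm{RG}(f)$ be the smallest closed interval containing the range of $f$ and, for $\varepsilon>0$, let $B_\varepsilon(f)$ be the set of $\mathbb K$-simple $g\colon[0,1)\to I$ with $|\mathrm{RG}(g)\setminus\mathrm{RG}(f)|<\varepsilon$ and $\|f-g\|_1<\varepsilon$, where $|\cdot|$ is Lebesgue measure. For an integrable $f\colon[a,b)\to I$ (with $a<b$) let $\tilde f(u)=f(a+u(b-a))$, $u\in[0,1)$, and $$\mathscr M^L(f)=\lim_{\varepsilon\to0^+}\inf_{g\in B_\varepsilon(\tilde f)}\mathscr M g(x)\,dx,\qquad \mathscr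 M^U(f)=\lim_{\varepsilon\to0^+}\sup_{g\in B_\varepsilon(\tilde f)}\mathscr M g(x)\,dx$$ (values in $[0,\infty]$). Let $\mathscr M^0(f)$ be the common value of $\mathscr M^L(f)$ and $\mathscr M^U(f)$, defined for those $f$ for which they agree. For $\mathfrak N\in\{\mathscr M^L,\mathscr M^U,\mathscr M^0\}$ the integral Hardy constant $\mathrm{iHc}(\mathfrak N)$ is the smallest $C\in[0,\infty]$ (again $\infty$ if no finite $C$ works) with $$\int_0^\infty\mathfrak N\big(f|_{[0,t)}\big)\,dt\le C\int_0^\infty f(t)\,dt$$ for every integrable $f\colon[0,\infty)\to I$ for which $\mathfrak N(f|_{[0,t)})$ is defined for almost every $t>0$ (no restriction for $\mathscr M^L$ and $\mathscr M^U$). Theorem. Let $\mathscr M$ be a symmetric and monotone $\mathbb K$-weighted mean on $I$, where $\inf I=0$. If $I$ has a greatest element, assume also that $\mathscr M$ is continuous in entries. Then $$\mathrm{iHc}(\mathscr M^L)=\mathrm{iHc}(\mathscr M^U)=\mathrm{iHc}(\mathscr M^0)=\mathrm{Hc}(\mathscr M).$$ -/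

import Mathlib

open Set MeasureTheory
open scoped ENNReal

namespace HardyMeans

/-- `W_n(K)`: the `n`-dimensional weight vectors over the field `K`. -/
def IsWeight (K : Subfield ℝ) {n : ℕ} (w : Fin n → ℝ) : Prop :=
  (∀ i, w i ∈ K ∧ 0 ≤ w i) ∧ 0 < ∑ i, w i

/-- The shuffle `(p₁, q₁, p₂, q₂, …, pₙ, qₙ)` of two vectors. -/
def shuffle {n : ℕ} (p q : Fin n → ℝ) : Fin (n * 2) → ℝ :=
  fun k => if k.modNat = 0 then p k.divNat else q k.divNat

/-- A `K`-weighted mean on `I`. The value of `toFun n x w` matters only for `x ∈ Iⁿ` and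
`w ∈ W_n(K)`; note that `W_0(K)` is empty. -/
structure WeightedMean (K : Subfield ℝ) (I : Set ℝ) where
  toFun : (n : ℕ) → (Fin n → ℝ) → (Fin n → ℝ) → ℝ
  mem : ∀ (n : ℕ) (x w : Fin n → ℝ), (∀ i, x i ∈ I) → IsWeight K w → toFun n x w ∈ I
  /-- nullhomogeneity in the weights -/
  nullhomogeneous : ∀ (n : ℕ) (x w : Fin n → ℝ) (t : ℝ), (∀ i, x i ∈ I) → IsWeight K w →
    t ∈ K → 0 < t → toFun n x (fun i => t * w i) = toFun n x w
  /-- reduction principle -/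
  reduction : ∀ (n : ℕ) (x v w : Fin n → ℝ), (∀ i, x i ∈ I) → IsWeight K v → IsWeight K w →
    toFun n x (fun i => v i + w i) = toFun (n * 2) (shuffle x x) (shuffle v w)
  /-- mean value property: the value lies between the least and the greatest entry -/
  mean_value : ∀ (n : ℕ) (x w : Fin n → ℝ), (∀ i, x i ∈ I) → IsWeight K w →
    (∃ i, x i ≤ toFun n x w) ∧ (∃ j, toFun n x w ≤ x j)
  /-- elimination principle: an entry of weight zero can be dropped -/
  elimination : ∀ (n : ℕ) (x w : Fin (n + 1) → ℝ) (j : Fin (n + 1)), (∀ i, x i ∈ I) →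
    IsWeight K w → w j = 0 →
    toFun (n + 1) x w = toFun n (fun i => x (j.succAbove i)) (fun i => w (j.succAbove i))

variable {K : Subfield ℝ} {I : Set ℝ}

namespace WeightedMean

/-- The mean is invariant under simultaneous permutations of entries and weights. -/
def IsSymmetric (M : WeightedMean K I) : Prop :=
  ∀ (n : ℕ) (x w : Fin n → ℝ) (σ : Equiv.Perm (Fin n)), (∀ i, x i ∈ I) → IsWeight K w →
    M.toFun n (x ∘ σ) (w ∘ σ) = M.toFun n x w

/-- The mean is nondecreasing in each of its entries. -/
def IsMonotone (M : WeightedMean K I) : Prop :=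
  ∀ (n : ℕ) (x y w : Fin n → ℝ), (∀ i, x i ∈ I) → (∀ i, y i ∈ I) → IsWeight K w →
    (∀ i, x i ≤ y i) → M.toFun n x w ≤ M.toFun n y w

/-- For every fixed weight vector the mean is continuous on `Iⁿ`. -/
def IsContinuousInEntries (M : WeightedMean K I) : Prop :=
  ∀ (n : ℕ) (w : Fin n → ℝ), IsWeight K w →
    ContinuousOn (fun x => M.toFun n x w) {x : Fin n → ℝ | ∀ i, x i ∈ I}

/-- The (weighted, discrete) Hardy constant `Hc(M)`: the smallest `C ∈ [0, ∞]` with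
`∑ wₙ M((x₁,…,xₙ),(w₁,…,wₙ)) ≤ C ∑ wₙ xₙ` for all sequences of positive elements `xₙ` of `I` and
`wₙ` of `K` (indexed from `0` here). It is `∞` when no finite `C` works. -/
noncomputable def hardyConst (M : WeightedMean K I) : ℝ≥0∞ :=
  sInf {C : ℝ≥0∞ | ∀ x w : ℕ → ℝ, (∀ n, x n ∈ I ∧ 0 < x n) → (∀ n, w n ∈ K ∧ 0 < w n) →
    ∑' n, ENNReal.ofReal
        (w n * M.toFun (n + 1) (fun i : Fin (n + 1) => x i) (fun i : Fin (n + 1) => w i))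
      ≤ C * ∑' n, ENNReal.ofReal (w n * x n)}

end WeightedMean

/-- A `K`-simple function `[0,1) → I`, given by division points `0 = s₀ < s₁ < … < sₙ = 1` in `K`
and by its values `yᵢ ∈ I` on the intervals `[sᵢ, sᵢ₊₁)`. -/
structure SimpleFn (K : Subfield ℝ) (I : Set ℝ) where
  n : ℕ
  s : Fin (n + 1) → ℝ
  y : Fin n → ℝ
  s_mem : ∀ i, s i ∈ K
  s_strictMono : StrictMono s
  s_zero : s 0 = 0
  s_last : s (Fin.last n) = 1
  y_mem : ∀ i, y i ∈ I

/-- The function itself (extended by `0` outside `[0,1)`). -/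
noncomputable def SimpleFn.toFun (g : SimpleFn K I) (u : ℝ) : ℝ :=
  ∑ i, (Ico (g.s i.castSucc) (g.s i.succ)).indicator (fun _ => g.y i) u

/-- The integral-type notation `M g(x) dx` for a `K`-simple function: the mean of the values,
weighted by the lengths of the intervals. By the axioms of a weighted mean it does not depend on
the division that is used to present `g`. -/
def WeightedMean.simple (M : WeightedMean K I) (g : SimpleFn K I) : ℝ :=
  M.toFun g.n g.y (fun i => g.s i.succ - g.s i.castSucc)

/-- The smallest closed interval that contains the range of `f` on `[0,1)`. -/
def rangeHull (f : ℝ → ℝ) : Set ℝ :=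
  closure (convexHull ℝ (f '' Ico 0 1))

/-- `B_ε(f)` for `f : [0,1) → I`: the `K`-simple functions `g : [0,1) → I` whose range hull exceeds
that of `f` by a set of measure less than `ε` and whose `L¹` distance to `f` is less than `ε`. -/
def nhdSimple (K : Subfield ℝ) (I : Set ℝ) (ε : ℝ) (f : ℝ → ℝ) : Set (SimpleFn K I) :=
  {g | volume (rangeHull g.toFun \ rangeHull f) < ENNReal.ofReal ε ∧
    ∫⁻ u in Ico (0 : ℝ) 1, ENNReal.ofReal |f u - g.toFun u| < ENNReal.ofReal ε}

/-- `f|_{[a,b)}` transported to `[0,1)` by the increasing affine bijection. -/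
def rescale (a b : ℝ) (f : ℝ → ℝ) : ℝ → ℝ :=
  fun u => f (a + u * (b - a))

namespace WeightedMean

/-- The lower integral mean `M^L(f|_{[a,b)})`, where `a < b`: the limit as `ε ↓ 0` of the infimum
of `M g(x) dx` over the `g` in `B_ε` of the rescaled function. The infimum grows as `ε` decreases,
so that the limit is the supremum over `ε > 0`. It may be infinite if `f` is unbounded. -/
noncomputable def lower (M : WeightedMean K I) (a b : ℝ) (f : ℝ → ℝ) : EReal :=
  ⨆ ε : {ε : ℝ // 0 < ε}, ⨅ g ∈ nhdSimple K I ε (rescale a b f), (M.simple g : EReal)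

/-- The upper integral mean `M^U(f|_{[a,b)})`, where `a < b`. -/
noncomputable def upper (M : WeightedMean K I) (a b : ℝ) (f : ℝ → ℝ) : EReal :=
  ⨅ ε : {ε : ℝ // 0 < ε}, ⨆ g ∈ nhdSimple K I ε (rescale a b f), (M.simple g : EReal)

/-- `M^0(f|_{[a,b)})` is well-defined. -/
def ExtDefined (M : WeightedMean K I) (a b : ℝ) (f : ℝ → ℝ) : Prop :=
  M.lower a b f = M.upper a b f

/-- `M^0(f|_{[a,b)})`, the common value of the lower and the upper mean where they agree. -/
noncomputable def ext (M : WeightedMean K I) (a b : ℝ) (f : ℝ → ℝ) : EReal :=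
  M.lower a b f

end WeightedMean

/-- The integral Hardy constant of a functional mean `N` on an interval `I ⊆ [0, ∞)` whose domain
is given by `D` (`D a b f` says that `f|_{[a,b)}` belongs to the domain, and then `N a b f` is the
mean of `f|_{[a,b)}`): the smallest `C ∈ [0, ∞]` with
`∫₀^∞ N(f|_{[0,t)}) dt ≤ C ∫₀^∞ f(t) dt` for all integrable `f : [0, ∞) → I` such that
`N(f|_{[0,t)})` is defined for almost every `t > 0`. It is `∞` when no finite `C` works. -/
noncomputable def integralHardyConstOn (I : Set ℝ) (D : ℝ → ℝ → (ℝ → ℝ) → Prop)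
    (N : ℝ → ℝ → (ℝ → ℝ) → EReal) : ℝ≥0∞ :=
  sInf {C : ℝ≥0∞ | ∀ f : ℝ → ℝ, MapsTo f (Ici 0) I → IntegrableOn f (Ici 0) →
    (∀ᵐ t ∂(volume.restrict (Ioi (0 : ℝ))), D 0 t f) →
    ∫⁻ t in Ioi (0 : ℝ), (N 0 t f).toENNReal ≤ C * ∫⁻ t in Ioi (0 : ℝ), ENNReal.ofReal (f t)}

/-- The integral Hardy constant of a functional mean that is defined on all integrable functions
on bounded intervals with values in `I`. -/
noncomputable def integralHardyConst (I : Set ℝ) (N : ℝ → ℝ → (ℝ → ℝ) → EReal) : ℝ≥0∞ :=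
  integralHardyConstOn I (fun _ _ _ => True) N

end HardyMeans

namespace HardyMeans

/-!
The theorem is the chain `Hc(M) ≤ iHc(M⁰) ≤ iHc(Mᴸ) ≤ iHc(Mᵁ) ≤ Hc(M)`; its two middle inequalities
are immediate.

A symmetric monotone mean only depends on the distribution of the entries with respect to the
weights, and it is monotone for the stochastic order: cut the weights of both tuples into the
pieces of their quantile coupling and compare entry by entry.

For `iHc(Mᵁ) ≤ Hc(M)`, the upper mean of `f` on `[0, t)` is approached by tuples whose distribution
exceeds that of `f` only slightly. Choose such a tuple for each point of a finite grid of values of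
`t`, stretch its decreasing rearrangement to the length `t`, and let `X` be the maximum of these
step functions. The sum of `X` exceeds the integral of `f` only slightly, whereas each prefix mean
of `X` with equal weights dominates the mean of the corresponding tuple, so the discrete inequality
for `X` bounds a Riemann sum of the integral of the upper means.

For `Hc(M) ≤ iHc(M⁰)`, let `f` be a continuous decreasing function that lies slightly above the
decreasing rearrangement of `x_1, …, x_N` laid out with the weights `w_1, …, w_N`. Up to time
`w_1 + ⋯ + w_n` the mean of `f` dominates that of `x_1, …, x_n`. Replacing `f` by a generic multiple
`r f` makes `M⁰` defined at almost every time, because monotone functions have countably many jumps.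
Room above the `x_n` is needed for `f` to take values in `I`; when `I` has a greatest element, it is
gained by truncating the `x_n`, and continuity in the entries removes the truncation.
-/

variable {K : Subfield ℝ} {I : Set ℝ}

/-! ### Dependence of a symmetric mean on the weight distribution -/

theorem IsWeight.comp_injective {n m : ℕ} {w : Fin n → ℝ} (hw : IsWeight K w)
    {e : Fin m → Fin n} (he : e.Injective) (h0 : ∀ i ∉ range e, w i = 0) :
    IsWeight K (w ∘ e) := by
  have hsum : ∑ i, w (e i) = ∑ i, w i := by
    rw [← Finset.sum_image (f := w) he.injOn]
    exact Finset.sum_subset (Finset.subset_univ _) fun i _ hi => h0 i (by simpa using hi)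
  exact ⟨fun i => hw.1 (e i), hsum ▸ hw.2⟩

theorem IsWeight.comp_succAbove {n : ℕ} {w : Fin (n + 1) → ℝ} (hw : IsWeight K w)
    {j : Fin (n + 1)} (hj : w j = 0) : IsWeight K (w ∘ j.succAbove) :=
  hw.comp_injective Fin.succAbove_right_injective fun i hi => by
    obtain rfl : i = j := by simpa using hi
    exact hj

theorem IsWeight.comp_perm {n : ℕ} {w : Fin n → ℝ} (hw : IsWeight K w) (σ : Equiv.Perm (Fin n)) :
    IsWeight K (w ∘ σ) :=
  hw.comp_injective σ.injective fun i hi => absurd (σ.surjective i) hi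

theorem IsWeight.add {n : ℕ} {v w : Fin n → ℝ} (hv : IsWeight K v) (hw : IsWeight K w) :
    IsWeight K (v + w) := by
  refine ⟨fun i => ⟨K.add_mem (hv.1 i).1 (hw.1 i).1, add_nonneg (hv.1 i).2 (hw.1 i).2⟩, ?_⟩
  simpa only [Pi.add_apply, Finset.sum_add_distrib] using add_pos hv.2 hw.2

theorem isWeight_single {n : ℕ} (a : Fin n) {c : ℝ} (hc : c ∈ K) (hc0 : 0 < c) :
    IsWeight K (Pi.single a c) := by
  refine ⟨fun i => ?_, by simpa using hc0⟩
  rcases eq_or_ne i a with rfl | hi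
  · simpa using ⟨hc, hc0.le⟩
  · simp [hi]

theorem isWeight_of_pos {n : ℕ} [NeZero n] {w : Fin n → ℝ} (hw : ∀ i, w i ∈ K ∧ 0 < w i) :
    IsWeight K w :=
  ⟨fun i => ⟨(hw i).1, (hw i).2.le⟩, Finset.sum_pos (fun i _ => (hw i).2) Finset.univ_nonempty⟩

theorem shuffle_finProdFinEquiv {n : ℕ} (p q : Fin n → ℝ) (l : Fin n) (c : Fin 2) :
    shuffle p q (finProdFinEquiv (l, c)) = if c = 0 then p l else q l := by
  have h := finProdFinEquiv.symm_apply_apply (l, c)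
  have hdiv : (finProdFinEquiv (l, c)).divNat = l := congrArg Prod.fst h
  have hmod : (finProdFinEquiv (l, c)).modNat = c := congrArg Prod.snd h
  rw [shuffle, hdiv, hmod]

theorem sum_shuffle {n : ℕ} (p q : Fin n → ℝ) :
    ∑ k, shuffle p q k = ∑ i, p i + ∑ i, q i := by
  rw [← finProdFinEquiv.sum_comp, Fintype.sum_prod_type]
  simp [shuffle_finProdFinEquiv, Finset.sum_add_distrib]

theorem IsWeight.shuffle {n : ℕ} {v w : Fin n → ℝ} (hv : IsWeight K v) (hw : IsWeight K w) :
    IsWeight K (shuffle v w) := by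
  refine ⟨fun k => ?_, by simpa only [sum_shuffle] using add_pos hv.2 hw.2⟩
  unfold HardyMeans.shuffle
  split_ifs
  exacts [hv.1 _, hw.1 _]

namespace WeightedMean

variable (M : WeightedMean K I)

theorem toFun_comp_injective (hsymm : M.IsSymmetric) {n m : ℕ} {x w : Fin n → ℝ}
    (hx : ∀ i, x i ∈ I) (hw : IsWeight K w) {e : Fin m → Fin n} (he : e.Injective)
    (h0 : ∀ i ∉ range e, w i = 0) :
    M.toFun m (x ∘ e) (w ∘ e) = M.toFun n x w := by
  induction n with
  | zero => exact absurd hw.2 (by simp)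
  | succ n ih =>
    by_cases hsurj : e.Surjective
    · obtain rfl : m = n + 1 := by simpa using Fintype.card_of_bijective ⟨he, hsurj⟩
      exact hsymm _ x w (Equiv.ofBijective e ⟨he, hsurj⟩) hx hw
    · obtain ⟨j, hj⟩ := not_forall.mp hsurj
      have hwj : w j = 0 := h0 j hj
      choose e' he' using fun k => Fin.exists_succAbove_eq fun h : e k = j => hj ⟨k, h⟩
      obtain rfl : e = j.succAbove ∘ e' := funext fun k => (he' k).symm
      rw [M.elimination n x w j hx hw hwj]
      refine ih (x := x ∘ j.succAbove) (fun i => hx _) (hw.comp_succAbove hwj) he.of_comp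
        fun i hi => h0 _ ?_
      rintro ⟨k, hk⟩
      exact hi ⟨k, Fin.succAbove_right_injective hk⟩

theorem toFun_add_single (hsymm : M.IsSymmetric) {n : ℕ} {x w : Fin n → ℝ}
    (hx : ∀ i, x i ∈ I) (hw : IsWeight K w) (a : Fin n) {c : ℝ} (hc : c ∈ K) (hc0 : 0 < c) :
    M.toFun n x (w + Pi.single a c) = M.toFun (n + 1) (Fin.cons (x a) x) (Fin.cons c w) := by
  have hu := isWeight_single a hc hc0
  let e : Fin (n + 1) → Fin (n * 2) :=
    Fin.cons (finProdFinEquiv (a, 1)) fun l => finProdFinEquiv (l, 0)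
  have he : e.Injective := by
    refine Fin.cons_injective_iff.mpr ⟨by simp, fun l l' h => ?_⟩
    simpa using finProdFinEquiv.injective h
  have hshuffle (p q : Fin n → ℝ) : shuffle p q ∘ e = Fin.cons (q a) p := by
    funext i
    cases i using Fin.cases <;> simp [e, shuffle_finProdFinEquiv]
  have hzero : ∀ k ∉ range e, shuffle w (Pi.single a c) k = 0 := by
    intro k hk
    obtain ⟨⟨l, b⟩, rfl⟩ := finProdFinEquiv.surjective k
    rw [shuffle_finProdFinEquiv]
    obtain rfl | rfl : b = 0 ∨ b = 1 := by omega
    · exact absurd ⟨l.succ, rfl⟩ hk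
    · have hla : l ≠ a := by
        rintro rfl
        exact hk ⟨0, rfl⟩
      simp [hla]
  have hxI : ∀ k, shuffle x x k ∈ I := fun k => by
    unfold shuffle
    split_ifs <;> exact hx _
  have hdrop := M.toFun_comp_injective hsymm hxI (hw.shuffle hu) he hzero
  rw [hshuffle, hshuffle, Pi.single_eq_same] at hdrop
  exact (M.reduction n x w _ hx hw hu).trans hdrop.symm

theorem toFun_eq_cons_succAbove (hsymm : M.IsSymmetric) {n : ℕ} {x w : Fin (n + 1) → ℝ}
    (hx : ∀ i, x i ∈ I) (hw : IsWeight K w) (b : Fin (n + 1)) :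
    M.toFun (n + 1) x w =
      M.toFun (n + 1) (Fin.cons (x b) (x ∘ b.succAbove)) (Fin.cons (w b) (w ∘ b.succAbove)) := by
  have hcomp (p : Fin (n + 1) → ℝ) :
      p ∘ b.cycleRange.symm = Fin.cons (p b) (p ∘ b.succAbove) := by
    funext i
    cases i using Fin.cases <;> simp
  rw [← hsymm _ x w b.cycleRange.symm hx hw, hcomp, hcomp]

/-- The mean of a finitely supported distribution of weights on `I`: a normal form for the tuples
that are equivalent under the axioms of a symmetric weighted mean. -/
noncomputable def distrib (μ : ℝ →₀ ℝ) : ℝ :=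
  M.toFun μ.support.card (fun i => (μ.support.equivFin.symm i : ℝ))
    (fun i => μ (μ.support.equivFin.symm i : ℝ))

theorem toFun_eq_distrib_of_injective (hsymm : M.IsSymmetric) {n : ℕ} {x w : Fin n → ℝ}
    (hx : ∀ i, x i ∈ I) (hw : IsWeight K w) (hpos : ∀ i, w i ≠ 0) (hinj : x.Injective) :
    M.toFun n x w = M.distrib (∑ i, Finsupp.single (x i) (w i)) := by
  set μ : ℝ →₀ ℝ := ∑ i, Finsupp.single (x i) (w i) with hμ
  have hval (i) : μ (x i) = w i := by
    simp [hμ, Finsupp.finsetSum_apply, Finsupp.single_apply, hinj.eq_iff]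
  have hsupp (s) (hs : s ∈ μ.support) : ∃ i, x i = s := by
    by_contra! hne
    simp [hμ, Finsupp.finsetSum_apply, hne] at hs
  choose e he using fun k : Fin μ.support.card => hsupp _ (μ.support.equivFin.symm k).2
  have he_inj : e.Injective := fun k l hkl =>
    μ.support.equivFin.symm.injective (Subtype.ext ((he k).symm.trans (hkl ▸ he l)))
  have he_surj : e.Surjective := fun i => by
    have hi : x i ∈ μ.support := by simpa [hval] using hpos i
    exact ⟨μ.support.equivFin ⟨x i, hi⟩, hinj (by simp [he])⟩
  rw [← M.toFun_comp_injective hsymm hx hw he_inj fun i hi => absurd (he_surj i) hi, distrib]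
  congr 1 <;> funext k
  · exact he k
  · simp [← he k, hval]

theorem toFun_eq_distrib (hsymm : M.IsSymmetric) {n : ℕ} {x w : Fin n → ℝ}
    (hx : ∀ i, x i ∈ I) (hw : IsWeight K w) :
    M.toFun n x w = M.distrib (∑ i, Finsupp.single (x i) (w i)) := by
  induction n with
  | zero => exact absurd hw.2 (by simp)
  | succ n ih =>
    by_cases hzero : ∃ j, w j = 0
    · obtain ⟨j, hj⟩ := hzero
      rw [M.elimination n x w j hx hw hj, Fin.sum_univ_succAbove _ j, hj, Finsupp.single_zero,
        zero_add]
      exact ih (fun i => hx _) (hw.comp_succAbove hj)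
    push Not at hzero
    by_cases hinj : x.Injective
    · exact M.toFun_eq_distrib_of_injective hsymm hx hw hzero hinj
    have hpos (i) : 0 < w i := (hw.1 i).2.lt_of_ne' (hzero i)
    obtain ⟨c, b, hcb, hne⟩ : ∃ c b, x c = x b ∧ c ≠ b := by
      simpa [Function.Injective] using hinj
    obtain ⟨a, rfl⟩ := Fin.exists_succAbove_eq hne
    have : NeZero n := ⟨by rintro rfl; exact a.elim0⟩
    have hw' : IsWeight K (w ∘ b.succAbove) := isWeight_of_pos fun i => ⟨(hw.1 _).1, hpos _⟩
    have hmerge := M.toFun_add_single hsymm (x := x ∘ b.succAbove) (fun i => hx _) hw' a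
      (hw.1 b).1 (hpos b)
    rw [M.toFun_eq_cons_succAbove hsymm hx hw b, ← hcb, ← Function.comp_apply (f := x), ← hmerge,
      ih (x := x ∘ b.succAbove) (fun i => hx _) (hw'.add (isWeight_single a (hw.1 b).1 (hpos b))),
      Fin.sum_univ_succAbove _ b]
    simp only [Pi.add_apply, Finsupp.single_add, Finset.sum_add_distrib, Function.comp_apply]
    rw [add_comm, Finset.sum_eq_single a (fun i _ hi => by simp [hi]) (by simp),
      Pi.single_eq_same, hcb]

end WeightedMean

/-! ### Monotonicity with respect to stochastic dominance -/

/-- The tail of the distribution of the entries `x` with weights `w`: the total weight of the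
entries that exceed `s`. -/
noncomputable def tailSum {n : ℕ} (x w : Fin n → ℝ) (s : ℝ) : ℝ :=
  ∑ i with s < x i, w i

section tailSum

variable {n : ℕ} {x w : Fin n → ℝ}

theorem tailSum_nonneg (hw : ∀ i, 0 ≤ w i) (s : ℝ) : 0 ≤ tailSum x w s :=
  Finset.sum_nonneg fun i _ => hw i

theorem tailSum_le_sum (hw : ∀ i, 0 ≤ w i) (s : ℝ) : tailSum x w s ≤ ∑ i, w i :=
  Finset.sum_le_univ_sum_of_nonneg hw

theorem antitone_tailSum (hw : ∀ i, 0 ≤ w i) : Antitone (tailSum x w) := fun _ _ hst =>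
  Finset.sum_le_sum_of_subset_of_nonneg
    (Finset.monotone_filter_right _ fun _ _ h => hst.trans_lt h) fun i _ _ => hw i

theorem tailSum_comp_perm (x w : Fin n → ℝ) (σ : Equiv.Perm (Fin n)) (s : ℝ) :
    tailSum (x ∘ σ) (w ∘ σ) s = tailSum x w s := by
  simp only [tailSum, Finset.sum_filter]
  exact Equiv.sum_comp σ fun i => if s < x i then w i else 0

end tailSum

/-- The total weight of the first `k` entries. -/
noncomputable def partialWeight {n : ℕ} (w : Fin n → ℝ) (k : ℕ) : ℝ :=
  ∑ i with i.val < k, w i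

section partialWeight

variable {n : ℕ} {w : Fin n → ℝ}

theorem partialWeight_zero (w : Fin n → ℝ) : partialWeight w 0 = 0 := by simp [partialWeight]

theorem partialWeight_eq_sum (w : Fin n → ℝ) : partialWeight w n = ∑ i, w i := by
  simp [partialWeight]

theorem partialWeight_succ (w : Fin n → ℝ) (i : Fin n) :
    partialWeight w (i + 1) = partialWeight w i + w i := by
  have hfilter : Finset.univ.filter (fun j : Fin n => j.val < i + 1) =
      insert i (Finset.univ.filter fun j : Fin n => j.val < i) := by
    ext j
    simp [Fin.ext_iff]
    omega
  rw [partialWeight, hfilter, Finset.sum_insert (by simp), add_comm, partialWeight]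

theorem partialWeight_mem (hw : IsWeight K w) (k : ℕ) : partialWeight w k ∈ K :=
  K.sum_mem fun i _ => (hw.1 i).1

theorem partialWeight_mono (hw : IsWeight K w) : Monotone (partialWeight w) := fun _ _ hkl =>
  Finset.sum_le_sum_of_subset_of_nonneg
    (Finset.monotone_filter_right _ fun _ _ h => lt_of_lt_of_le h hkl) fun i _ _ => (hw.1 i).2

theorem partialWeight_nonneg (hw : IsWeight K w) (k : ℕ) : 0 ≤ partialWeight w k :=
  Finset.sum_nonneg fun i _ => (hw.1 i).2

theorem partialWeight_le_sum (hw : IsWeight K w) (k : ℕ) : partialWeight w k ≤ ∑ i, w i :=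
  Finset.sum_le_univ_sum_of_nonneg fun i => (hw.1 i).2

theorem partialWeight_succ_le_tailSum (hw : IsWeight K w) {x : Fin n → ℝ} (hx : Antitone x)
    {i : Fin n} {s : ℝ} (hi : s < x i) : partialWeight w (i + 1) ≤ tailSum x w s :=
  Finset.sum_le_sum_of_subset_of_nonneg
    (Finset.monotone_filter_right _ fun _ _ h => hi.trans_le (hx (Nat.lt_succ_iff.mp h)))
    fun i _ _ => (hw.1 i).2

theorem tailSum_le_partialWeight (hw : IsWeight K w) {x : Fin n → ℝ} (hx : Antitone x)
    {j : Fin n} {s : ℝ} (hj : x j ≤ s) : tailSum x w s ≤ partialWeight w j :=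
  Finset.sum_le_sum_of_subset_of_nonneg
    (Finset.monotone_filter_right _ fun _ _ h => hx.reflect_lt (hj.trans_lt h))
    fun i _ _ => (hw.1 i).2

end partialWeight

theorem max_zero_min_sub_max_eq {a a' b b' : ℝ} (ha : a ≤ a') (hb : b ≤ b') :
    max 0 (min a' b' - max a b) = max a (min a' b') - max a (min a' b) := by
  grind

/-- The quantile coupling of two weight vectors of equal total weight: lay their entries out as
consecutive intervals, and take the length of the intersection of the `i`-th interval of the first
with the `j`-th interval of the second. -/
noncomputable def coupling {n m : ℕ} (v : Fin n → ℝ) (w : Fin m → ℝ) (i : Fin n) (j : Fin m) : ℝ :=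
  max 0 (min (partialWeight v (i + 1)) (partialWeight w (j + 1)) -
    max (partialWeight v i) (partialWeight w j))

section coupling

variable {n m : ℕ} {v : Fin n → ℝ} {w : Fin m → ℝ}

theorem coupling_comm (v : Fin n → ℝ) (w : Fin m → ℝ) (i : Fin n) (j : Fin m) :
    coupling v w i j = coupling w v j i := by
  rw [coupling, coupling, min_comm, max_comm (partialWeight v i)]

theorem coupling_nonneg (v : Fin n → ℝ) (w : Fin m → ℝ) (i : Fin n) (j : Fin m) :
    0 ≤ coupling v w i j :=
  le_max_left _ _

theorem coupling_mem (hv : IsWeight K v) (hw : IsWeight K w) (i : Fin n) (j : Fin m) :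
    coupling v w i j ∈ K :=
  max_rec' (· ∈ K) K.zero_mem <| K.sub_mem
    (min_rec' (· ∈ K) (partialWeight_mem hv _) (partialWeight_mem hw _))
    (max_rec' (· ∈ K) (partialWeight_mem hv _) (partialWeight_mem hw _))

theorem sum_coupling (hv : IsWeight K v) (hw : IsWeight K w) (h : ∑ i, v i = ∑ j, w j)
    (i : Fin n) : ∑ j, coupling v w i j = v i := by
  have hv_mono := partialWeight_mono hv (Nat.le_add_right i.val 1)
  let clamp (k : ℕ) := max (partialWeight v i) (min (partialWeight v (i + 1)) (partialWeight w k))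
  have hterm (j : Fin m) : coupling v w i j = clamp (j + 1) - clamp j :=
    max_zero_min_sub_max_eq hv_mono (partialWeight_mono hw (Nat.le_add_right _ 1))
  have hzero : clamp 0 = partialWeight v i := by
    simp only [clamp, partialWeight_zero]
    rw [min_eq_right (partialWeight_nonneg hv _), max_eq_left (partialWeight_nonneg hv _)]
  have htop : clamp m = partialWeight v (i + 1) := by
    simp only [clamp, partialWeight_eq_sum, ← h]
    rw [min_eq_left (partialWeight_le_sum hv _), max_eq_right hv_mono]
  simp only [hterm]
  rw [Fin.sum_univ_eq_sum_range (fun j => clamp (j + 1) - clamp j) m, Finset.sum_range_sub, hzero,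
    htop, partialWeight_succ, add_sub_cancel_left]

theorem le_of_coupling_ne_zero (hv : IsWeight K v) (hw : IsWeight K w) {x : Fin n → ℝ}
    {y : Fin m → ℝ} (hx : Antitone x) (hy : Antitone y)
    (hdom : ∀ s, tailSum x v s ≤ tailSum y w s) {i : Fin n} {j : Fin m}
    (hij : coupling v w i j ≠ 0) : x i ≤ y j := by
  contrapose! hij
  have hle : partialWeight v (i + 1) ≤ partialWeight w j :=
    (partialWeight_succ_le_tailSum hv hx hij).trans <|
      (hdom _).trans (tailSum_le_partialWeight hw hy le_rfl)
  exact max_eq_left <| sub_nonpos.mpr <|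
    (min_le_left _ _).trans (hle.trans (le_max_right _ _))

end coupling

namespace WeightedMean

variable (M : WeightedMean K I)

theorem toFun_eq_of_sum_fiber (hsymm : M.IsSymmetric) {n N : ℕ} {x w : Fin n → ℝ}
    {z c : Fin N → ℝ} (hx : ∀ i, x i ∈ I) (hw : IsWeight K w) (hz : ∀ k, z k ∈ I)
    (hc : IsWeight K c) (π : Fin N → Fin n) (hzx : ∀ k, c k ≠ 0 → z k = x (π k))
    (hcw : ∀ i, ∑ k with π k = i, c k = w i) :
    M.toFun N z c = M.toFun n x w := by
  rw [M.toFun_eq_distrib hsymm hz hc, M.toFun_eq_distrib hsymm hx hw]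
  congr 1
  rw [← Finset.sum_fiberwise Finset.univ π]
  refine Finset.sum_congr rfl fun i _ => ?_
  rw [← hcw i, Finsupp.single_finsetSum]
  refine Finset.sum_congr rfl fun k hk => ?_
  obtain rfl : π k = i := (Finset.mem_filter.mp hk).2
  rcases eq_or_ne (c k) 0 with hck | hck
  · simp [hck]
  · rw [hzx k hck]

theorem toFun_le_of_coupling (hsymm : M.IsSymmetric) (hmono : M.IsMonotone) {n m : ℕ}
    {x v : Fin n → ℝ} {y w : Fin m → ℝ} (hx : ∀ i, x i ∈ I) (hy : ∀ i, y i ∈ I)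
    (hv : IsWeight K v) (hw : IsWeight K w) (c : Fin n → Fin m → ℝ)
    (hcK : ∀ i j, c i j ∈ K ∧ 0 ≤ c i j) (hcv : ∀ i, ∑ j, c i j = v i)
    (hcw : ∀ j, ∑ i, c i j = w j) (hle : ∀ i j, c i j ≠ 0 → x i ≤ y j) :
    M.toFun n x v ≤ M.toFun m y w := by
  let e : Fin (n * m) ≃ Fin n × Fin m := finProdFinEquiv.symm
  have hsum (F : Fin n × Fin m → ℝ) : ∑ k, F (e k) = ∑ i, ∑ j, F (i, j) := by
    rw [e.sum_comp F, Fintype.sum_prod_type]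
  have hc : IsWeight K fun k => c (e k).1 (e k).2 := by
    refine ⟨fun k => hcK _ _, ?_⟩
    rw [hsum fun p => c p.1 p.2]
    simpa only [hcv] using hv.2
  have hzI (k) : min (x (e k).1) (y (e k).2) ∈ I := min_rec' (· ∈ I) (hx _) (hy _)
  calc M.toFun n x v
      = M.toFun (n * m) (fun k => min (x (e k).1) (y (e k).2)) fun k => c (e k).1 (e k).2 := by
        refine (M.toFun_eq_of_sum_fiber hsymm hx hv hzI hc (fun k => (e k).1)
          (fun k hk => min_eq_left (hle _ _ hk)) fun i => ?_).symm
        rw [Finset.sum_filter, hsum fun p => if p.1 = i then c p.1 p.2 else 0]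
        simpa [Finset.sum_comm (s := (Finset.univ : Finset (Fin n)))] using hcv i
    _ ≤ M.toFun (n * m) (fun k => y (e k).2) fun k => c (e k).1 (e k).2 :=
        hmono _ _ _ _ hzI (fun k => hy _) hc fun k => min_le_right _ _
    _ = M.toFun m y w := by
        refine M.toFun_eq_of_sum_fiber hsymm hy hw (fun k => hy _) hc (fun k => (e k).2)
          (fun _ _ => rfl) fun j => ?_
        rw [Finset.sum_filter, hsum fun p => if p.2 = j then c p.1 p.2 else 0]
        simpa using hcw j

theorem toFun_le_of_tailSum_le_of_antitone (hsymm : M.IsSymmetric) (hmono : M.IsMonotone)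
    {n m : ℕ} {x v : Fin n → ℝ} {y w : Fin m → ℝ} (hx : ∀ i, x i ∈ I) (hy : ∀ i, y i ∈ I)
    (hv : IsWeight K v) (hw : IsWeight K w) (hsum : ∑ i, v i = ∑ j, w j)
    (hx_anti : Antitone x) (hy_anti : Antitone y) (hdom : ∀ s, tailSum x v s ≤ tailSum y w s) :
    M.toFun n x v ≤ M.toFun m y w :=
  M.toFun_le_of_coupling hsymm hmono hx hy hv hw (coupling v w)
    (fun i j => ⟨coupling_mem hv hw i j, coupling_nonneg v w i j⟩) (sum_coupling hv hw hsum)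
    (fun j => by simpa only [coupling_comm v w] using sum_coupling hw hv hsum.symm j)
    fun _ _ => le_of_coupling_ne_zero hv hw hx_anti hy_anti hdom

theorem toFun_le_of_tailSum_le (hsymm : M.IsSymmetric) (hmono : M.IsMonotone)
    {n m : ℕ} {x v : Fin n → ℝ} {y w : Fin m → ℝ} (hx : ∀ i, x i ∈ I) (hy : ∀ i, y i ∈ I)
    (hv : IsWeight K v) (hw : IsWeight K w) (hsum : ∑ i, v i = ∑ j, w j)
    (hdom : ∀ s, tailSum x v s ≤ tailSum y w s) :
    M.toFun n x v ≤ M.toFun m y w := by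
  have antitone_comp_sort {k : ℕ} (z : Fin k → ℝ) : Antitone (z ∘ Tuple.sort fun i => -z i) :=
    fun a b hab => neg_le_neg_iff.mp (Tuple.monotone_sort (fun i => -z i) hab)
  rw [← hsymm n x v (Tuple.sort fun i => -x i) hx hv,
    ← hsymm m y w (Tuple.sort fun i => -y i) hy hw]
  refine M.toFun_le_of_tailSum_le_of_antitone hsymm hmono (fun i => hx _) (fun i => hy _)
    (hv.comp_perm _) (hw.comp_perm _) ?_ (antitone_comp_sort x) (antitone_comp_sort y) fun s => ?_
  · simpa only [Function.comp_apply, Equiv.sum_comp] using hsum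
  · simpa only [tailSum_comp_perm] using hdom s

end WeightedMean

/-! ### Weighted tuples and simple functions -/

/-- A tuple with entries in `I` and with weights in `K` whose sum is `1`: a finitely supported
probability distribution on `I`. -/
structure WeightedTuple (K : Subfield ℝ) (I : Set ℝ) where
  n : ℕ
  entry : Fin n → ℝ
  weight : Fin n → ℝ
  entry_mem : ∀ i, entry i ∈ I
  isWeight : IsWeight K weight
  sum_weight : ∑ i, weight i = 1

namespace WeightedTuple

/-- The total weight of the entries that exceed `s`. -/
noncomputable def tail (d : WeightedTuple K I) : ℝ → ℝ := tailSum d.entry d.weight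

/-- The tuple with entries `x` and with the weights `w` divided by their sum. -/
noncomputable def normalize {n : ℕ} (x w : Fin n → ℝ) (hx : ∀ i, x i ∈ I) (hw : IsWeight K w) :
    WeightedTuple K I where
  n := n
  entry := x
  weight := fun i => (∑ j, w j)⁻¹ * w i
  entry_mem := hx
  isWeight := by
    have hsum : ∑ j, w j ∈ K := K.sum_mem fun i _ => (hw.1 i).1
    refine ⟨fun i => ⟨K.mul_mem (K.inv_mem hsum) (hw.1 i).1,
      mul_nonneg (inv_nonneg.mpr hw.2.le) (hw.1 i).2⟩, ?_⟩
    rw [← Finset.mul_sum, inv_mul_cancel₀ hw.2.ne']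
    exact one_pos
  sum_weight := by rw [← Finset.mul_sum, inv_mul_cancel₀ hw.2.ne']

theorem tail_normalize {n : ℕ} (x w : Fin n → ℝ) (hx : ∀ i, x i ∈ I) (hw : IsWeight K w) (s : ℝ) :
    (normalize x w hx hw).tail s = (∑ j, w j)⁻¹ * tailSum x w s := by
  rw [tailSum, Finset.mul_sum]
  rfl

theorem weight_nonneg (d : WeightedTuple K I) (i : Fin d.n) : 0 ≤ d.weight i :=
  (d.isWeight.1 i).2

theorem tail_nonneg (d : WeightedTuple K I) (s : ℝ) : 0 ≤ d.tail s :=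
  tailSum_nonneg d.weight_nonneg s

theorem tail_le_one (d : WeightedTuple K I) (s : ℝ) : d.tail s ≤ 1 :=
  (tailSum_le_sum d.weight_nonneg s).trans_eq d.sum_weight

theorem antitone_tail (d : WeightedTuple K I) : Antitone d.tail :=
  antitone_tailSum d.weight_nonneg

end WeightedTuple

namespace WeightedMean

variable (M : WeightedMean K I)

/-- The mean of a weighted tuple. -/
def val (d : WeightedTuple K I) : ℝ := M.toFun d.n d.entry d.weight

theorem val_normalize {n : ℕ} (x w : Fin n → ℝ) (hx : ∀ i, x i ∈ I) (hw : IsWeight K w) :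
    M.val (WeightedTuple.normalize x w hx hw) = M.toFun n x w :=
  M.nullhomogeneous n x w _ hx hw (K.inv_mem (K.sum_mem fun i _ => (hw.1 i).1))
    (inv_pos.mpr hw.2)

theorem val_mem (d : WeightedTuple K I) : M.val d ∈ I := M.mem _ _ _ d.entry_mem d.isWeight

theorem val_le_val (hsymm : M.IsSymmetric) (hmono : M.IsMonotone) {d d' : WeightedTuple K I}
    (h : ∀ s, d.tail s ≤ d'.tail s) : M.val d ≤ M.val d' :=
  M.toFun_le_of_tailSum_le hsymm hmono d.entry_mem d'.entry_mem d.isWeight d'.isWeight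
    (d.sum_weight.trans d'.sum_weight.symm) h

end WeightedMean

/-- The set of points of `[0, 1)` at which `f` exceeds `s`. -/
def superlevel (f : ℝ → ℝ) (s : ℝ) : Set ℝ := {u | u ∈ Ico (0 : ℝ) 1 ∧ s < f u}

theorem superlevel_eq_empty {f : ℝ → ℝ} {s : ℝ} (h : ∀ u ∈ Ico (0 : ℝ) 1, f u ≤ s) :
    superlevel f s = ∅ :=
  eq_empty_of_forall_notMem fun u hu => (h u hu.1).not_gt hu.2

namespace SimpleFn

variable (g : SimpleFn K I)

theorem pairwise_disjoint_Ico :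
    Pairwise (Function.onFun Disjoint fun i : Fin g.n => Ico (g.s i.castSucc) (g.s i.succ)) := by
  refine (symm_disjoint.comap _).pairwise_on _ |>.mpr fun i j hij => ?_
  refine Set.disjoint_left.mpr fun u hi hj => (hi.2.trans_le ?_).not_ge hj.1
  exact g.s_strictMono.monotone (Fin.succ_le_castSucc_iff.mpr hij)

theorem toFun_eq {u : ℝ} {i : Fin g.n} (hu : u ∈ Ico (g.s i.castSucc) (g.s i.succ)) :
    g.toFun u = g.y i := by
  rw [toFun, Finset.sum_eq_single i (fun j _ hji => indicator_of_notMem ?_ _) (by simp),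
    indicator_of_mem hu]
  exact fun hj => (g.pairwise_disjoint_Ico hji).le_bot ⟨hj, hu⟩

theorem exists_mem_Ico {u : ℝ} (hu : u ∈ Ico (0 : ℝ) 1) :
    ∃ i : Fin g.n, u ∈ Ico (g.s i.castSucc) (g.s i.succ) := by
  obtain ⟨k, hk, hmax⟩ := (Finset.univ.filter fun k => g.s k ≤ u).exists_max_image id
    ⟨0, by simp [g.s_zero, hu.1]⟩
  simp only [Finset.mem_filter, Finset.mem_univ, true_and, id] at hk hmax
  obtain ⟨i, rfl⟩ := Fin.exists_castSucc_eq.mpr fun hlast : k = Fin.last g.n =>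
    hu.2.not_ge (by rwa [hlast, g.s_last] at hk)
  exact ⟨i, hk, lt_of_not_ge fun hle => (hmax _ hle).not_gt Fin.castSucc_lt_succ⟩

theorem measurable_toFun : Measurable g.toFun := by
  unfold toFun
  exact Finset.measurable_fun_sum _ fun i _ => measurable_const.indicator measurableSet_Ico

theorem sum_length : ∑ i : Fin g.n, (g.s i.succ - g.s i.castSucc) = 1 := by
  have h := Fin.sum_univ_succ g.s
  rw [Fin.sum_univ_castSucc, g.s_zero, g.s_last] at h
  rw [Finset.sum_sub_distrib]
  linarith

/-- The values of a simple function, weighted by the lengths of the intervals. -/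
noncomputable def tuple : WeightedTuple K I where
  n := g.n
  entry := g.y
  weight := fun i => g.s i.succ - g.s i.castSucc
  entry_mem := g.y_mem
  isWeight := ⟨fun _ => ⟨K.sub_mem (g.s_mem _) (g.s_mem _),
    sub_nonneg.mpr (g.s_strictMono Fin.castSucc_lt_succ).le⟩, g.sum_length ▸ one_pos⟩
  sum_weight := g.sum_length

theorem superlevel_toFun (s : ℝ) :
    superlevel g.toFun s =
      ⋃ i ∈ Finset.univ.filter fun i => s < g.y i, Ico (g.s i.castSucc) (g.s i.succ) := by
  ext u
  simp only [Finset.mem_filter, Finset.mem_univ, true_and, mem_iUnion, exists_prop]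
  constructor
  · rintro ⟨hu, hs⟩
    obtain ⟨i, hi⟩ := g.exists_mem_Ico hu
    exact ⟨i, g.toFun_eq hi ▸ hs, hi⟩
  · rintro ⟨i, hs, hi⟩
    refine ⟨⟨?_, ?_⟩, (g.toFun_eq hi).symm ▸ hs⟩
    · exact g.s_zero ▸ (g.s_strictMono.monotone (Fin.zero_le _)).trans hi.1
    · exact g.s_last ▸ hi.2.trans_le (g.s_strictMono.monotone (Fin.le_last _))

theorem volume_superlevel (s : ℝ) :
    volume (superlevel g.toFun s) = ENNReal.ofReal (g.tuple.tail s) := by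
  rw [g.superlevel_toFun, measure_biUnion_finset (fun _ _ _ _ hij => g.pairwise_disjoint_Ico hij)
    fun _ _ => measurableSet_Ico]
  simp only [Real.volume_Ico]
  exact (ENNReal.ofReal_sum_of_nonneg fun i _ => g.tuple.weight_nonneg i).symm

end SimpleFn

theorem WeightedMean.simple_eq_val (M : WeightedMean K I) (g : SimpleFn K I) :
    M.simple g = M.val g.tuple := rfl

theorem exists_simpleFn_near (K : Subfield ℝ) {φ : ℝ → ℝ} (hφ : ContinuousOn φ (Icc 0 1))
    (hI : MapsTo φ (Ico 0 1) I) {ε : ℝ} (hε : 0 < ε) :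
    ∃ g : SimpleFn K I, ∀ u ∈ Ico (0 : ℝ) 1,
      g.toFun u ∈ φ '' Ico 0 1 ∧ |φ u - g.toFun u| ≤ ε := by
  obtain ⟨δ, hδ, hφδ⟩ := Metric.uniformContinuousOn_iff_le.mp
    (isCompact_Icc.uniformContinuousOn_of_continuous hφ) ε hε
  obtain ⟨N, hN⟩ := exists_nat_one_div_lt hδ
  have hN0 : (0 : ℝ) < N + 1 := by positivity
  have hmem (i : Fin (N + 1)) : (i : ℝ) / (N + 1) ∈ Ico (0 : ℝ) 1 :=
    ⟨by positivity, (div_lt_one hN0).mpr (by exact_mod_cast i.2)⟩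
  let g : SimpleFn K I :=
    { n := N + 1
      s := fun i => (i : ℝ) / (N + 1)
      y := fun i => φ ((i : ℝ) / (N + 1))
      s_mem := fun i => K.div_mem (natCast_mem K _) (K.add_mem (natCast_mem K _) K.one_mem)
      s_strictMono := fun i j hij => div_lt_div_of_pos_right (by exact_mod_cast hij) hN0
      s_zero := by simp
      s_last := by simp [div_self hN0.ne']
      y_mem := fun i => hI (hmem i) }
  refine ⟨g, fun u hu => ?_⟩
  obtain ⟨i, hi⟩ := g.exists_mem_Ico hu
  rw [g.toFun_eq hi]
  refine ⟨mem_image_of_mem φ (hmem i), hφδ u (Ico_subset_Icc_self hu) _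
    (Ico_subset_Icc_self (hmem i)) ?_⟩
  have hlower : (i : ℝ) / (N + 1) ≤ u := hi.1
  have hupper : u < (i : ℝ) / (N + 1) + 1 / (N + 1) := by simpa [g, add_div] using hi.2
  rw [Real.dist_eq, abs_of_nonneg (sub_nonneg.mpr hlower)]
  linarith

/-! ### The neighbourhoods `B_ε(f)` -/

theorem rangeHull_subset {f : ℝ → ℝ} {S : Set ℝ} (hS : IsClosed S) (hc : Convex ℝ S)
    (h : MapsTo f (Ico 0 1) S) : rangeHull f ⊆ S :=
  closure_minimal (convexHull_min h.image_subset hc) hS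

theorem Icc_subset_rangeHull {f : ℝ → ℝ} {u v : ℝ} (hu : u ∈ Ico (0 : ℝ) 1)
    (hv : v ∈ Ico (0 : ℝ) 1) : Icc (f u) (f v) ⊆ rangeHull f :=
  ((convex_convexHull ℝ _).ordConnected.out (subset_convexHull ℝ _ (mem_image_of_mem f hu))
    (subset_convexHull ℝ _ (mem_image_of_mem f hv))).trans subset_closure

theorem nhdSimple_mono {f : ℝ → ℝ} {ε ε' : ℝ} (h : ε ≤ ε') :
    nhdSimple K I ε f ⊆ nhdSimple K I ε' f := fun _ hg =>
  ⟨hg.1.trans_le (ENNReal.ofReal_le_ofReal h), hg.2.trans_le (ENNReal.ofReal_le_ofReal h)⟩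

section nhdSimple

variable {f : ℝ → ℝ} {ε S : ℝ} {g : SimpleFn K I}

theorem exists_abs_sub_lt (hg : g ∈ nhdSimple K I ε f) :
    ∃ u ∈ Ico (0 : ℝ) 1, |f u - g.toFun u| < ε := by
  by_contra! hfar
  refine hg.2.not_ge ?_
  calc ENNReal.ofReal ε = ∫⁻ _ in Ico (0 : ℝ) 1, ENNReal.ofReal ε := by simp
    _ ≤ ∫⁻ u in Ico (0 : ℝ) 1, ENNReal.ofReal |f u - g.toFun u| :=
      setLIntegral_mono' measurableSet_Ico fun u hu => ENNReal.ofReal_le_ofReal (hfar u hu)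

theorem toFun_le_of_mem_nhdSimple (hg : g ∈ nhdSimple K I ε f) (hf : ∀ u ∈ Ico (0 : ℝ) 1, f u ≤ S)
    {u : ℝ} (hu : u ∈ Ico (0 : ℝ) 1) : g.toFun u ≤ S + 2 * ε := by
  by_contra! hlarge
  obtain ⟨v, hv, hfg⟩ := exists_abs_sub_lt hg
  have hfv := hf v hv
  have hsub : Icc (S + ε) (S + 2 * ε) ⊆ rangeHull g.toFun \ rangeHull f := by
    rintro z ⟨hz1, hz2⟩
    refine ⟨Icc_subset_rangeHull hv hu ⟨by grind, by linarith⟩, fun hz => ?_⟩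
    have : z ≤ S := rangeHull_subset isClosed_Iic (convex_Iic S) hf hz
    grind
  have hvol := (measure_mono hsub).trans_lt hg.1
  rw [Real.volume_Icc, show S + 2 * ε - (S + ε) = ε by ring] at hvol
  exact lt_irrefl _ hvol

theorem le_toFun_of_mem_nhdSimple (hg : g ∈ nhdSimple K I ε f) (hf : ∀ u ∈ Ico (0 : ℝ) 1, S ≤ f u)
    {u : ℝ} (hu : u ∈ Ico (0 : ℝ) 1) : S - 2 * ε ≤ g.toFun u := by
  by_contra! hsmall
  obtain ⟨v, hv, hfg⟩ := exists_abs_sub_lt hg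
  have hfv := hf v hv
  have hsub : Icc (S - 2 * ε) (S - ε) ⊆ rangeHull g.toFun \ rangeHull f := by
    rintro z ⟨hz1, hz2⟩
    refine ⟨Icc_subset_rangeHull hu hv ⟨by linarith, by grind⟩, fun hz => ?_⟩
    have : S ≤ z := rangeHull_subset isClosed_Ici (convex_Ici S) hf hz
    grind
  have hvol := (measure_mono hsub).trans_lt hg.1
  rw [Real.volume_Icc, show S - ε - (S - 2 * ε) = ε by ring] at hvol
  exact lt_irrefl _ hvol

end nhdSimple

theorem abs_sub_projIcc_le {a b y : ℝ} (hab : a ≤ b) (hy : y ∈ Icc a b) (z : ℝ) :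
    |z - projIcc a b hab z| ≤ |y - z| := by
  obtain ⟨ha, hb⟩ := hy
  rw [coe_projIcc]
  grind

theorem exists_projIcc_near {f : ℝ → ℝ} (hf : IntegrableOn f (Ico 0 1)) {ε : ℝ≥0∞} (hε : 0 < ε) :
    ∃ a ∈ f '' Ico 0 1, ∃ b ∈ f '' Ico 0 1, ∃ hab : a ≤ b,
      ∫⁻ u in Ico (0 : ℝ) 1, ‖f u - projIcc a b hab (f u)‖ₑ < ε := by
  obtain ⟨f', hf'_meas, hff'⟩ := hf.aestronglyMeasurable.aemeasurable
  have h0 : f 0 ∈ f '' Ico 0 1 := ⟨0, by simp, rfl⟩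
  have hlim := SimpleFunc.tendsto_approxOn_L1_enorm hf'_meas h0
    (μ := volume.restrict (Ico (0 : ℝ) 1)) (by
      filter_upwards [hff', ae_restrict_mem measurableSet_Ico] with u hu hu'
      exact subset_closure ⟨u, hu', hu⟩)
    (((hf.congr hff').sub (integrable_const (f 0))).2)
  obtain ⟨N, hN⟩ := (hlim.eventually (gt_mem_nhds hε)).exists
  set σ := SimpleFunc.approxOn f' hf'_meas (f '' Ico 0 1) (f 0) h0 N
  have hne : σ.range.Nonempty := ⟨σ 0, SimpleFunc.mem_range_self σ 0⟩
  have hrange (z) (hz : z ∈ σ.range) : z ∈ f '' Ico 0 1 := by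
    obtain ⟨u, rfl⟩ := SimpleFunc.mem_range.mp hz
    exact SimpleFunc.approxOn_mem hf'_meas h0 N u
  refine ⟨σ.range.min' hne, hrange _ (Finset.min'_mem _ _), σ.range.max' hne,
    hrange _ (Finset.max'_mem _ _), Finset.min'_le _ _ (Finset.max'_mem _ _),
    (lintegral_mono_ae ?_).trans_lt hN⟩
  filter_upwards [hff'] with u hu
  rw [← hu, Real.enorm_eq_ofReal_abs, Real.enorm_eq_ofReal_abs]
  exact ENNReal.ofReal_le_ofReal <| abs_sub_projIcc_le _
    ⟨Finset.min'_le _ _ (SimpleFunc.mem_range_self σ u),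
      Finset.le_max' _ _ (SimpleFunc.mem_range_self σ u)⟩ _

theorem nhdSimple_nonempty (K : Subfield ℝ) (hI : I.OrdConnected) {f : ℝ → ℝ}
    (hf : IntegrableOn f (Ico 0 1)) (hfI : MapsTo f (Ico 0 1) I) {ε : ℝ} (hε : 0 < ε) :
    (nhdSimple K I ε f).Nonempty := by
  have hε4 : 0 < ε / 4 := by positivity
  obtain ⟨a, ha, b, hb, hab, hclamp⟩ := exists_projIcc_near hf (ENNReal.ofReal_pos.mpr hε4)
  obtain ⟨φ, hφ, -⟩ := Integrable.exists_boundedContinuous_lintegral_sub_le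
    (μ := volume.restrict (Ico (0 : ℝ) 1)) hf (ENNReal.ofReal_pos.mpr hε4).ne'
  let clamp (z : ℝ) : ℝ := projIcc a b hab z
  have hclamp_lip (z z' : ℝ) : |clamp z - clamp z'| ≤ |z - z'| := abs_projIcc_sub_projIcc hab
  obtain ⟨g, hg⟩ := exists_simpleFn_near (I := I) K (φ := fun u => clamp (φ u))
    (continuous_subtype_val.comp (continuous_projIcc.comp φ.continuous)).continuousOn
    (fun u _ => hI.out (hfI.image_subset ha) (hfI.image_subset hb) (projIcc a b hab (φ u)).2) hε4
  have hfm := hf.aestronglyMeasurable.aemeasurable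
  refine ⟨g, ?_, ?_⟩
  · obtain ⟨ua, hua, rfl⟩ := ha
    obtain ⟨ub, hub, rfl⟩ := hb
    have hsub : rangeHull g.toFun ⊆ rangeHull f := by
      refine (rangeHull_subset isClosed_Icc (convex_Icc (f ua) (f ub)) fun u hu => ?_).trans
        (Icc_subset_rangeHull hua hub)
      obtain ⟨v, -, hv⟩ := (hg u hu).1
      exact hv ▸ (projIcc (f ua) (f ub) hab (φ v)).2
    rw [sdiff_eq_empty.mpr hsub, measure_empty]
    exact ENNReal.ofReal_pos.mpr hε
  calc ∫⁻ u in Ico (0 : ℝ) 1, ENNReal.ofReal |f u - g.toFun u|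
      ≤ ∫⁻ u in Ico (0 : ℝ) 1,
          (‖f u - clamp (f u)‖ₑ + (‖f u - φ u‖ₑ + ENNReal.ofReal (ε / 4))) := by
        refine setLIntegral_mono' measurableSet_Ico fun u hu => ?_
        simp only [Real.enorm_eq_ofReal_abs]
        rw [← ENNReal.ofReal_add (abs_nonneg _) hε4.le,
          ← ENNReal.ofReal_add (abs_nonneg _) (by positivity)]
        refine ENNReal.ofReal_le_ofReal ((abs_sub_le _ (clamp (f u)) _).trans ?_)
        gcongr
        exact (abs_sub_le _ (clamp (φ u)) _).trans (add_le_add (hclamp_lip _ _) (hg u hu).2)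
    _ = (∫⁻ u in Ico (0 : ℝ) 1, ‖f u - clamp (f u)‖ₑ) +
          ((∫⁻ u in Ico (0 : ℝ) 1, ‖f u - φ u‖ₑ) + ENNReal.ofReal (ε / 4)) := by
        rw [lintegral_add_right', lintegral_add_right _ measurable_const]
        · simp
        · exact (hfm.sub φ.continuous.aemeasurable).enorm.add aemeasurable_const
    _ ≤ ENNReal.ofReal (ε / 4) + (ENNReal.ofReal (ε / 4) + ENNReal.ofReal (ε / 4)) :=
        add_le_add hclamp.le (add_le_add hφ le_rfl)
    _ < ENNReal.ofReal ε := by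
        rw [← ENNReal.ofReal_add hε4.le hε4.le, ← ENNReal.ofReal_add hε4.le (by positivity)]
        exact (ENNReal.ofReal_lt_ofReal_iff hε).mpr (by linarith)

theorem integrableOn_rescale {f : ℝ → ℝ} {a b : ℝ} (hab : a < b) (hf : IntegrableOn f (Ico a b)) :
    IntegrableOn (rescale a b f) (Ico 0 1) := by
  rw [← integrable_indicator_iff measurableSet_Ico] at hf ⊢
  have hlen : 0 < b - a := sub_pos.mpr hab
  refine ((hf.comp_add_left a).comp_mul_right' hlen.ne').congr (.of_forall fun u => ?_)
  have hmem : a + u * (b - a) ∈ Ico a b ↔ u ∈ Ico 0 1 := by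
    rw [mem_Ico, mem_Ico, le_add_iff_nonneg_right, mul_nonneg_iff_of_pos_right hlen,
      ← lt_sub_iff_add_lt', mul_lt_iff_lt_one_left hlen]
  beta_reduce
  by_cases hu : u ∈ Ico (0 : ℝ) 1
  · rw [indicator_of_mem (hmem.mpr hu), indicator_of_mem hu, rescale]
  · rw [indicator_of_notMem (mt hmem.mp hu), indicator_of_notMem hu]

theorem mapsTo_rescale {f : ℝ → ℝ} {a b : ℝ} (hab : a < b) (hf : MapsTo f (Ico a b) I) :
    MapsTo (rescale a b f) (Ico 0 1) I := fun u hu => by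
  refine hf ⟨?_, ?_⟩ <;> nlinarith [hu.1, hu.2]

theorem WeightedMean.lower_le_upper (M : WeightedMean K I) (hI : I.OrdConnected) {f : ℝ → ℝ}
    {a b : ℝ} (hab : a < b) (hf : IntegrableOn f (Ico a b)) (hfI : MapsTo f (Ico a b) I) :
    M.lower a b f ≤ M.upper a b f := by
  refine iSup_le fun ε => le_iInf fun ε' => ?_
  obtain ⟨g, hg⟩ := nhdSimple_nonempty K hI (integrableOn_rescale hab hf)
    (mapsTo_rescale hab hfI) (lt_min ε.2 ε'.2)
  exact (iInf₂_le g (nhdSimple_mono (min_le_left _ _) hg)).trans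
    (le_iSup₂ (f := fun (g : SimpleFn K I) _ => (M.simple g : EReal)) g
      (nhdSimple_mono (min_le_right _ _) hg))

/-! ### Envelopes of finitely many tuples -/

theorem mem_of_pos_of_le (hI : I.OrdConnected) (hI0 : IsGLB I 0) {p z : ℝ} (hp : p ∈ I)
    (hz : 0 < z) (hzp : z ≤ p) : z ∈ I := by
  obtain ⟨a, ha, -, haz⟩ := hI0.exists_between hz
  exact hI.out ha hp ⟨haz.le, hzp⟩

theorem exists_lt_iff_of_finite {A : Type*} [LinearOrder A] {P : A → Prop} {S : Set A}
    (hS : S.Finite) (hne : ∃ s, P s) (hP : ∀ s, P s → ∃ z ∈ S, s < z ∧ ∀ r < z, P r) :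
    ∃ z ∈ S, ∀ s, s < z ↔ P s := by
  obtain ⟨s₀, hs₀⟩ := hne
  obtain ⟨z₀, hz₀, -, hPz₀⟩ := hP s₀ hs₀
  obtain ⟨z, ⟨hz, hPz⟩, hmax⟩ := exists_max_image {z ∈ S | ∀ r < z, P r} id
    (hS.subset (sep_subset _ _)) ⟨z₀, hz₀, hPz₀⟩
  refine ⟨z, hz, fun s => ⟨hPz s, fun hs => ?_⟩⟩
  obtain ⟨z', hz', hsz', hPz'⟩ := hP s hs
  exact hsz'.trans_le (hmax z' ⟨hz', hPz'⟩)

theorem WeightedTuple.exists_lt_entry_of_lt_tail (d : WeightedTuple K I) {θ s : ℝ} (hθ : 0 ≤ θ)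
    (hs : θ < d.tail s) : ∃ i, s < d.entry i ∧ ∀ r < d.entry i, θ < d.tail r := by
  have hne : (Finset.univ.filter fun i => s < d.entry i).Nonempty :=
    Finset.nonempty_of_sum_ne_zero (hθ.trans_lt hs).ne'
  obtain ⟨i, hi, hmin⟩ := Finset.exists_min_image _ d.entry hne
  simp only [Finset.mem_filter, Finset.mem_univ, true_and] at hi hmin
  refine ⟨i, hi, fun r hr => hs.trans_le ?_⟩
  unfold tail tailSum
  exact Finset.sum_le_sum_of_subset_of_nonneg
    (Finset.monotone_filter_right _ fun j _ hj => hr.trans_le (hmin j hj))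
    fun j _ _ => d.weight_nonneg j

namespace WeightedMean

/-- The `n`-th mean in the Hardy inequality: the mean of `x 0, …, x n` with the weights
`w 0, …, w n`. -/
def prefixMean (M : WeightedMean K I) (x w : ℕ → ℝ) (n : ℕ) : ℝ :=
  M.toFun (n + 1) (fun i : Fin (n + 1) => x i) (fun i : Fin (n + 1) => w i)

end WeightedMean

/-- The sequence `X`, read as a step function on a grid of mesh `ω`, is the maximum of `κ` and of
the decreasing rearrangements of the tuples `d k`, stretched to the lengths `ℓ k`. This is expressed
through strict superlevel sets. -/
def IsEnvelope {N : ℕ} (d : Fin N → WeightedTuple K I) (ℓ : Fin N → ℝ) (ω κ : ℝ) (X : ℕ → ℝ) :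
    Prop :=
  ∀ (j : ℕ) (s : ℝ), s < X j ↔ s < κ ∨ ∃ k, j * ω < ℓ k * (d k).tail s

theorem sum_filter_mul_lt {ω : ℝ} (hω : 0 < ω) (P : ℝ) (J : ℕ) :
    ∑ _ ∈ {j : Fin J | (j : ℝ) * ω < P}, ω = (min J ⌈P / ω⌉₊ : ℕ) * ω := by
  have hfilter : Finset.univ.filter (fun j : Fin J => (j : ℝ) * ω < P) =
      Finset.univ.filter fun j : Fin J => j.val < ⌈P / ω⌉₊ :=
    Finset.filter_congr fun _ _ => by rw [Nat.lt_ceil, lt_div_iff₀ hω]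
  rw [hfilter, Finset.sum_const, Fin.card_filter_val_lt, nsmul_eq_mul]

section Envelope

variable {N : ℕ} {d : Fin N → WeightedTuple K I} {ℓ : Fin N → ℝ} {ω κ : ℝ} {X : ℕ → ℝ}

theorem exists_isEnvelope (d : Fin N → WeightedTuple K I) (hℓ : ∀ k, 0 < ℓ k) (hω : 0 ≤ ω)
    (hκ : κ ∈ I) : ∃ X : ℕ → ℝ, (∀ j, X j ∈ I) ∧ IsEnvelope d ℓ ω κ X := by
  have hfin : (insert κ (range fun q : Σ k, Fin (d k).n => (d q.1).entry q.2)).Finite :=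
    (finite_range _).insert κ
  have hP (j : ℕ) := exists_lt_iff_of_finite hfin
    (P := fun s => s < κ ∨ ∃ k, j * ω < ℓ k * (d k).tail s) ⟨κ - 1, .inl (sub_one_lt κ)⟩ <| by
      rintro s (hs | ⟨k, hk⟩)
      · exact ⟨κ, mem_insert _ _, hs, fun r hr => .inl hr⟩
      · obtain ⟨i, hi, hlt⟩ := (d k).exists_lt_entry_of_lt_tail (θ := j * ω / ℓ k)
          (div_nonneg (by positivity) (hℓ k).le) ((div_lt_iff₀' (hℓ k)).mpr hk)
        exact ⟨_, mem_insert_of_mem _ ⟨⟨k, i⟩, rfl⟩, hi,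
          fun r hr => .inr ⟨k, (div_lt_iff₀' (hℓ k)).mp (hlt r hr)⟩⟩
  choose X hX hlt using hP
  refine ⟨X, fun j => ?_, hlt⟩
  obtain h | ⟨q, h⟩ := hX j
  · exact h ▸ hκ
  · exact h ▸ (d q.1).entry_mem q.2

namespace IsEnvelope

variable (hX : IsEnvelope d ℓ ω κ X)
include hX

theorem le_apply (j : ℕ) : κ ≤ X j := le_of_forall_lt fun s hs => (hX j s).mpr (.inl hs)

theorem val_le_prefixMean {M : WeightedMean K I} (hsymm : M.IsSymmetric) (hmono : M.IsMonotone)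
    (hXI : ∀ j, X j ∈ I) (hω : 0 < ω) (hωK : ω ∈ K) (k : Fin N) {j : ℕ}
    (hj : (j + 1) * ω ≤ ℓ k) : M.val (d k) ≤ M.prefixMean X (fun _ => ω) j := by
  have hw : IsWeight K fun _ : Fin (j + 1) => ω := isWeight_of_pos fun _ => ⟨hωK, hω⟩
  rw [WeightedMean.prefixMean, ← M.val_normalize _ _ (fun i => hXI i) hw]
  refine M.val_le_val hsymm hmono fun s => ?_
  rw [WeightedTuple.tail_normalize, le_inv_mul_iff₀ hw.2]
  set P := ℓ k * (d k).tail s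
  have h0 := (d k).tail_nonneg s
  have hsum : ∑ _ : Fin (j + 1), ω = (j + 1) * ω := by simp
  calc (∑ _ : Fin (j + 1), ω) * (d k).tail s
      ≤ min ((j + 1) * ω) P := by
        rw [hsum]
        exact le_min (mul_le_of_le_one_right (by positivity) ((d k).tail_le_one s))
          (mul_le_mul_of_nonneg_right hj h0)
    _ ≤ (min (j + 1) ⌈P / ω⌉₊ : ℕ) * ω := by
        rw [Nat.cast_min, min_mul_of_nonneg _ _ hω.le]
        push_cast
        exact min_le_min_left _ ((div_le_iff₀ hω).mp (Nat.le_ceil _))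
    _ = ∑ _ ∈ {i : Fin (j + 1) | (i : ℝ) * ω < P}, ω := (sum_filter_mul_lt hω P (j + 1)).symm
    _ ≤ tailSum (fun i : Fin (j + 1) => X i) (fun _ => ω) s :=
        Finset.sum_le_sum_of_subset_of_nonneg
          (Finset.monotone_filter_right _ fun i _ hi => (hX i s).mpr (.inr ⟨k, hi⟩))
          fun _ _ _ => hω.le

theorem tailSum_eq_zero_or_le (hω : 0 < ω) (J : ℕ) {s : ℝ} (hs : κ ≤ s) :
    tailSum (fun j : Fin J => X j) (fun _ => ω) s = 0 ∨
      ∃ k, (d k).tail s ≠ 0 ∧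
        tailSum (fun j : Fin J => X j) (fun _ => ω) s ≤ ℓ k * (d k).tail s + ω := by
  refine or_iff_not_imp_left.mpr fun hne => ?_
  obtain ⟨j, hj, -⟩ := Finset.exists_ne_zero_of_sum_ne_zero hne
  obtain hlt | ⟨k₀, hk₀⟩ := (hX j s).mp (Finset.mem_filter.mp hj).2
  · exact absurd hlt hs.not_gt
  have : Nonempty (Fin N) := ⟨k₀⟩
  obtain ⟨k, hk⟩ := Finite.exists_max fun k => ℓ k * (d k).tail s
  have hpos : 0 < ℓ k * (d k).tail s :=
    (mul_nonneg j.val.cast_nonneg hω.le).trans_lt (hk₀.trans_le (hk k₀))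
  refine ⟨k, right_ne_zero_of_mul hpos.ne', ?_⟩
  calc tailSum (fun j : Fin J => X j) (fun _ => ω) s
      ≤ ∑ _ ∈ {j : Fin J | (j : ℝ) * ω < ℓ k * (d k).tail s}, ω := by
        refine Finset.sum_le_sum_of_subset_of_nonneg
          (Finset.monotone_filter_right _ fun i _ hi => ?_) fun _ _ _ => hω.le
        obtain hlt | ⟨k', hk'⟩ := (hX i s).mp hi
        · exact absurd hlt hs.not_gt
        · exact hk'.trans_le (hk k')
    _ ≤ ⌈ℓ k * (d k).tail s / ω⌉₊ * ω := by
        rw [sum_filter_mul_lt hω]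
        exact mul_le_mul_of_nonneg_right (Nat.cast_le.mpr (min_le_right _ _)) hω.le
    _ ≤ (ℓ k * (d k).tail s / ω + 1) * ω := by
        gcongr
        exact (Nat.ceil_lt_add_one (div_nonneg hpos.le hω.le)).le
    _ = ℓ k * (d k).tail s + ω := by rw [add_one_mul, div_mul_cancel₀ _ hω.ne']

end IsEnvelope

end Envelope

/-! ### From the discrete to the integral inequality -/

theorem le_of_forall_le_add_mul_one_div {a b c : ℝ≥0∞} (hc : c ≠ ∞)
    (h : ∀ n : ℕ, a ≤ b + c * ENNReal.ofReal (1 / ((n : ℝ) + 1))) : a ≤ b := by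
  have hlim : Filter.Tendsto (fun n : ℕ => ENNReal.ofReal (1 / ((n : ℝ) + 1))) Filter.atTop
      (nhds 0) := by
    simpa using ENNReal.tendsto_ofReal tendsto_one_div_add_atTop_nhds_zero_nat
  have hlim' := (ENNReal.Tendsto.const_mul hlim (Or.inr hc)).const_add b
  rw [mul_zero, add_zero] at hlim'
  exact ge_of_tendsto' hlim' h

theorem one_div_natCast_add_one_mem (K : Subfield ℝ) (n : ℕ) : 1 / ((n : ℝ) + 1) ∈ K :=
  K.div_mem K.one_mem (K.add_mem (natCast_mem K _) K.one_mem)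

theorem setLIntegral_Ioi_zero_indicator_Iio (a : ℝ) (c : ℝ≥0∞) :
    ∫⁻ s in Ioi (0 : ℝ), (Iio a).indicator (fun _ => c) s = c * ENNReal.ofReal a := by
  rw [lintegral_indicator_const measurableSet_Iio, Measure.restrict_apply measurableSet_Iio,
    inter_comm, Ioi_inter_Iio, Real.volume_Ioo, sub_zero]

theorem lintegral_ofReal_tailSum {n : ℕ} {x w : Fin n → ℝ} (hw : ∀ i, 0 ≤ w i) :
    ∫⁻ s in Ioi (0 : ℝ), ENNReal.ofReal (tailSum x w s) = ∑ i, ENNReal.ofReal (w i * x i) := by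
  have htail (s : ℝ) : ENNReal.ofReal (tailSum x w s) =
      ∑ i, (Iio (x i)).indicator (fun _ => ENNReal.ofReal (w i)) s := by
    rw [tailSum, ENNReal.ofReal_sum_of_nonneg fun i _ => hw i, Finset.sum_filter]
    rfl
  simp only [htail]
  rw [lintegral_finsetSum _ fun i _ => measurable_const.indicator measurableSet_Iio]
  refine Finset.sum_congr rfl fun i _ => ?_
  rw [setLIntegral_Ioi_zero_indicator_Iio, ENNReal.ofReal_mul (hw i)]

/-- The Hardy inequality of the mean holds with the constant `C`. -/
def WeightedMean.IsHardyBound (M : WeightedMean K I) (C : ℝ≥0∞) : Prop :=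
  ∀ x w : ℕ → ℝ, (∀ n, x n ∈ I ∧ 0 < x n) → (∀ n, w n ∈ K ∧ 0 < w n) →
    ∑' n, ENNReal.ofReal (w n * M.prefixMean x w n) ≤ C * ∑' n, ENNReal.ofReal (w n * x n)

/-- The tuples whose distribution exceeds a given one only slightly. Here `m s` is the measure of
the part of `[0, t)` on which a function on `[0, t)` exceeds `s`, so that `m s / t` is the
normalized tail that is compared with the one of the tuple, and the excess is truncated at `0`. -/
def excessTuples (K : Subfield ℝ) (I : Set ℝ) (m : ℝ → ℝ≥0∞) (ε t : ℝ) :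
    Set (WeightedTuple K I) :=
  {d | ∫⁻ s in Ioi (0 : ℝ), (ENNReal.ofReal (d.tail s) - m s / ENNReal.ofReal t) ≤
    ENNReal.ofReal ε}

theorem excessTuples_mono {m : ℝ → ℝ≥0∞} {ε t t' : ℝ} (h : t ≤ t') :
    excessTuples K I m ε t' ⊆ excessTuples K I m ε t := fun _ hd =>
  (lintegral_mono fun _ => by dsimp only; gcongr).trans hd

theorem excessTuples_nonempty (hI0 : IsGLB I 0) (m : ℝ → ℝ≥0∞) {ε : ℝ} (hε : 0 < ε) (t : ℝ) :
    (excessTuples K I m ε t).Nonempty := by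
  obtain ⟨z, hz, -, hzε⟩ := hI0.exists_between hε
  let d : WeightedTuple K I := .normalize (fun _ : Fin 1 => z) (fun _ => 1) (fun _ => hz)
    (isWeight_of_pos fun _ => ⟨K.one_mem, one_pos⟩)
  refine ⟨d, ?_⟩
  calc ∫⁻ s in Ioi (0 : ℝ), (ENNReal.ofReal (d.tail s) - m s / ENNReal.ofReal t)
      ≤ ∫⁻ s in Ioi (0 : ℝ), ENNReal.ofReal (d.tail s) := lintegral_mono fun _ => tsub_le_self
    _ = ∑ i, ENNReal.ofReal (d.weight i * d.entry i) := lintegral_ofReal_tailSum d.weight_nonneg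
    _ = ENNReal.ofReal z := (Fin.sum_univ_one _).trans (by simp [d, WeightedTuple.normalize])
    _ ≤ ENNReal.ofReal ε := ENNReal.ofReal_le_ofReal hzε.le

theorem lintegral_measure_mem_Ico {α : Type*} [MeasurableSpace α] {μ : Measure α} [SFinite μ]
    {f g : α → ℝ} (hf : AEMeasurable f μ) (hg : AEMeasurable g μ) :
    ∫⁻ s, μ {u | s ∈ Ico (f u) (g u)} = ∫⁻ u, ENNReal.ofReal (g u - f u) ∂μ := by
  obtain ⟨F, hF, hfF⟩ := hf
  obtain ⟨G, hG, hgG⟩ := hg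
  have hR : MeasurableSet {q : α × ℝ | q.2 ∈ Ico (F q.1) (G q.1)} :=
    (measurableSet_le (hF.comp measurable_fst) measurable_snd).inter
      (measurableSet_lt measurable_snd (hG.comp measurable_fst))
  calc ∫⁻ s, μ {u | s ∈ Ico (f u) (g u)}
      = ∫⁻ s, μ {u | s ∈ Ico (F u) (G u)} := by
        refine lintegral_congr fun s => measure_congr ?_
        filter_upwards [hfF, hgG] with u hfu hgu
        exact congrArg₂ (fun a b => s ∈ Ico a b) hfu hgu
    _ = ∫⁻ u, volume (Ico (F u) (G u)) ∂μ :=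
        (Measure.prod_apply_symm hR).symm.trans (Measure.prod_apply hR)
    _ = ∫⁻ u, ENNReal.ofReal (g u - f u) ∂μ := by
        refine lintegral_congr_ae ?_
        filter_upwards [hfF, hgG] with u hfu hgu
        rw [Real.volume_Ico, hfu, hgu]

theorem volume_superlevel_rescale_le {t : ℝ} (ht : 0 < t) (f : ℝ → ℝ) (s : ℝ) :
    volume (superlevel (rescale 0 t f) s) ≤
      volume {u | u ∈ Ici (0 : ℝ) ∧ s < f u} / ENNReal.ofReal t := by
  have hsub : superlevel (rescale 0 t f) s ⊆ (· * t) ⁻¹' {u | u ∈ Ici (0 : ℝ) ∧ s < f u} :=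
    fun u ⟨hu, hsu⟩ => ⟨mul_nonneg hu.1 ht.le, by simpa [rescale] using hsu⟩
  refine (measure_mono hsub).trans_eq ?_
  rw [Real.volume_preimage_mul_right ht.ne', abs_of_pos (inv_pos.mpr ht),
    ENNReal.ofReal_inv_of_pos ht, mul_comm, div_eq_mul_inv]

theorem tuple_mem_excessTuples {f : ℝ → ℝ} {t ε : ℝ} (ht : 0 < t) (hf : IntegrableOn f (Ico 0 t))
    {g : SimpleFn K I} (hg : g ∈ nhdSimple K I ε (rescale 0 t f)) :
    g.tuple ∈ excessTuples K I (fun s => volume {u | u ∈ Ici (0 : ℝ) ∧ s < f u}) ε t := by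
  set φ := rescale 0 t f
  have hφ := (integrableOn_rescale ht hf).aestronglyMeasurable.aemeasurable
  calc ∫⁻ s in Ioi (0 : ℝ), (ENNReal.ofReal (g.tuple.tail s) -
          volume {u | u ∈ Ici (0 : ℝ) ∧ s < f u} / ENNReal.ofReal t)
      ≤ ∫⁻ s, volume.restrict (Ico 0 1) {u | s ∈ Ico (φ u) (g.toFun u)} := by
        refine (setLIntegral_le_lintegral _ _).trans (lintegral_mono fun s => ?_)
        rw [← g.volume_superlevel, Measure.restrict_apply' measurableSet_Ico]
        refine (tsub_le_tsub_left (volume_superlevel_rescale_le ht f s) _).trans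
          (le_measure_sdiff.trans (measure_mono ?_))
        rintro u ⟨⟨hu, hsg⟩, hsf⟩
        exact ⟨⟨not_lt.mp fun hlt => hsf ⟨hu, hlt⟩, hsg⟩, hu⟩
    _ = ∫⁻ u in Ico (0 : ℝ) 1, ENNReal.ofReal (g.toFun u - φ u) :=
        lintegral_measure_mem_Ico hφ g.measurable_toFun.aemeasurable
    _ ≤ ∫⁻ u in Ico (0 : ℝ) 1, ENNReal.ofReal |φ u - g.toFun u| :=
        lintegral_mono fun u => ENNReal.ofReal_le_ofReal (by grind)
    _ ≤ ENNReal.ofReal ε := hg.2.le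

namespace IsEnvelope

variable {N : ℕ} {d : Fin N → WeightedTuple K I} {ℓ : Fin N → ℝ} {ω κ B ε : ℝ} {X : ℕ → ℝ}
  {m : ℝ → ℝ≥0∞} (hX : IsEnvelope d ℓ ω κ X) (hω : 0 < ω) (hℓ : ∀ k, 0 < ℓ k)
  (hB : ∀ k i, (d k).entry i ≤ B)
include hX hω hℓ hB

theorem ofReal_tailSum_le (m : ℝ → ℝ≥0∞) (J : ℕ) (s : ℝ) :
    ENNReal.ofReal (tailSum (fun n : Fin J => X n) (fun _ => ω) s) ≤
      (Iio κ).indicator (fun _ => ENNReal.ofReal (J * ω)) s +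
        (Iio B).indicator (fun _ => ENNReal.ofReal ω) s +
          (m s + ∑ k, ENNReal.ofReal (ℓ k) *
            (ENNReal.ofReal ((d k).tail s) - m s / ENNReal.ofReal (ℓ k))) := by
  rcases lt_or_ge s κ with hsκ | hsκ
  · rw [indicator_of_mem (mem_Iio.mpr hsκ), add_assoc]
    refine le_add_right (ENNReal.ofReal_le_ofReal ?_)
    exact (tailSum_le_sum (fun _ => hω.le) s).trans_eq (by simp)
  obtain h0 | ⟨k, hk, hle⟩ := hX.tailSum_eq_zero_or_le hω J hsκ
  · simp [h0]
  obtain ⟨i, hi, -⟩ : ∃ i, s < (d k).entry i ∧ (d k).weight i ≠ 0 := by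
    simpa using Finset.exists_ne_zero_of_sum_ne_zero
      (show ∑ i with s < (d k).entry i, (d k).weight i ≠ 0 from hk)
  rw [indicator_of_mem (mem_Iio.mpr (hi.trans_le (hB k i))), add_assoc]
  refine le_add_left ((ENNReal.ofReal_le_ofReal hle).trans ?_)
  rw [ENNReal.ofReal_add (mul_nonneg (hℓ k).le ((d k).tail_nonneg s)) hω.le, add_comm,
    ENNReal.ofReal_mul (hℓ k).le]
  let E (k : Fin N) := ENNReal.ofReal ((d k).tail s) - m s / ENNReal.ofReal (ℓ k)
  gcongr
  calc ENNReal.ofReal (ℓ k) * ENNReal.ofReal ((d k).tail s)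
      ≤ ENNReal.ofReal (ℓ k) * (m s / ENNReal.ofReal (ℓ k) + E k) := by
        gcongr
        exact le_add_tsub
    _ = m s + ENNReal.ofReal (ℓ k) * E k := by
        rw [mul_add, ENNReal.mul_div_cancel (ENNReal.ofReal_pos.mpr (hℓ k)).ne'
          ENNReal.ofReal_ne_top]
    _ ≤ m s + ∑ k, ENNReal.ofReal (ℓ k) * E k := by
        gcongr
        exact Finset.single_le_sum (f := fun k => ENNReal.ofReal (ℓ k) * E k)
          (fun _ _ => zero_le) (Finset.mem_univ k)

theorem sum_ofReal_mul_le (hm : Measurable m) (hd : ∀ k, d k ∈ excessTuples K I m ε (ℓ k))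
    (J : ℕ) :
    ∑ n ∈ Finset.range J, ENNReal.ofReal (ω * X n) ≤
      ENNReal.ofReal (J * ω) * ENNReal.ofReal κ + ENNReal.ofReal ω * ENNReal.ofReal B +
        ((∫⁻ s in Ioi (0 : ℝ), m s) + ∑ k, ENNReal.ofReal (ℓ k) * ENNReal.ofReal ε) := by
  let E (k : Fin N) (s : ℝ) := ENNReal.ofReal ((d k).tail s) - m s / ENNReal.ofReal (ℓ k)
  have hE (k) : Measurable (E k) :=
    (d k).antitone_tail.measurable.ennreal_ofReal.sub (hm.div_const _)
  have hEsum : Measurable fun s => ∑ k, ENNReal.ofReal (ℓ k) * E k s :=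
    Finset.measurable_fun_sum _ fun k _ => (hE k).const_mul _
  have hmE : Measurable fun s => m s + ∑ k, ENNReal.ofReal (ℓ k) * E k s := hm.add hEsum
  rw [Finset.sum_range, ← lintegral_ofReal_tailSum (x := fun n : Fin J => X n) fun _ => hω.le]
  refine (lintegral_mono fun s => hX.ofReal_tailSum_le hω hℓ hB m J s).trans ?_
  rw [lintegral_add_right _ hmE, lintegral_add_right _ hEsum,
    lintegral_add_right _ (measurable_const.indicator measurableSet_Iio),
    lintegral_finsetSum _ fun k _ => (hE k).const_mul _,
    setLIntegral_Ioi_zero_indicator_Iio, setLIntegral_Ioi_zero_indicator_Iio]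
  gcongr with k
  rw [lintegral_const_mul _ (hE k)]
  gcongr
  exact hd k

end IsEnvelope

namespace WeightedMean

variable {M : WeightedMean K I} {C : ℝ≥0∞} {m : ℝ → ℝ≥0∞}

theorem IsHardyBound.sum_range_le (hC : M.IsHardyBound C) (hC' : C ≠ ∞) {x w : ℕ → ℝ}
    (hx : ∀ n, x n ∈ I ∧ 0 < x n) (hw : ∀ n, w n ∈ K ∧ 0 < w n) (N : ℕ) :
    ∑ n ∈ Finset.range N, ENNReal.ofReal (w n * M.prefixMean x w n) ≤
      C * ∑ n ∈ Finset.range N, ENNReal.ofReal (w n * x n) := by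
  refine le_of_forall_le_add_mul_one_div (c := C * (ENNReal.ofReal (x 0) * 2))
    (ENNReal.mul_ne_top hC' (ENNReal.mul_ne_top ENNReal.ofReal_ne_top (by simp))) fun q => ?_
  set δ : ℝ := 1 / ((q : ℝ) + 1)
  have hδ : 0 < δ := by positivity
  let x' (n : ℕ) : ℝ := if n < N then x n else x 0
  let w' (n : ℕ) : ℝ := if n < N then w n else δ * (1 / 2) ^ n
  have hx' (n : ℕ) : x' n ∈ I ∧ 0 < x' n := by
    by_cases hn : n < N <;> simp only [x', hn, if_true, if_false, hx, and_self]
  have hw' (n : ℕ) : w' n ∈ K ∧ 0 < w' n := by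
    by_cases hn : n < N <;> simp only [w', hn, if_true, if_false, hw, and_self]
    exact ⟨K.mul_mem (one_div_natCast_add_one_mem K q)
      (K.pow_mem (K.div_mem K.one_mem (ofNat_mem K 2)) _), by positivity⟩
  have hprefix {n : ℕ} (hn : n < N) : M.prefixMean x' w' n = M.prefixMean x w n := by
    have hi (i : Fin (n + 1)) : (i : ℕ) < N := by lia
    simp only [prefixMean, x', w', hi, if_true]
  have hextend (n : ℕ) : ENNReal.ofReal (w' n * x' n) ≤
      (if n < N then ENNReal.ofReal (w n * x n) else 0) +
        ENNReal.ofReal δ * ENNReal.ofReal (x 0) * 2⁻¹ ^ n := by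
    by_cases hn : n < N <;> simp only [w', x', hn, if_true, if_false, le_self_add, zero_add]
    rw [mul_right_comm, ENNReal.ofReal_mul (mul_nonneg hδ.le (hx 0).2.le), ENNReal.ofReal_mul hδ.le,
      ENNReal.ofReal_pow (by norm_num), one_div, ENNReal.ofReal_inv_of_pos two_pos,
      ENNReal.ofReal_ofNat]
  calc ∑ n ∈ Finset.range N, ENNReal.ofReal (w n * M.prefixMean x w n)
      = ∑ n ∈ Finset.range N, ENNReal.ofReal (w' n * M.prefixMean x' w' n) :=
        Finset.sum_congr rfl fun n hn => by
          rw [hprefix (Finset.mem_range.mp hn)]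
          simp only [w', Finset.mem_range.mp hn, if_true]
    _ ≤ C * ∑' n, ENNReal.ofReal (w' n * x' n) := (ENNReal.sum_le_tsum _).trans (hC x' w' hx' hw')
    _ ≤ C * ∑' n, ((if n < N then ENNReal.ofReal (w n * x n) else 0) +
          ENNReal.ofReal δ * ENNReal.ofReal (x 0) * 2⁻¹ ^ n) :=
        mul_le_mul_right (ENNReal.tsum_le_tsum hextend) C
    _ = C * ∑ n ∈ Finset.range N, ENNReal.ofReal (w n * x n) +
          C * (ENNReal.ofReal (x 0) * 2) * ENNReal.ofReal δ := by
        rw [ENNReal.tsum_add, ENNReal.tsum_mul_left, ENNReal.tsum_geometric,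
          ENNReal.one_sub_inv_two, inv_inv,
          tsum_eq_sum (s := Finset.range N) fun n hn => if_neg (by simpa using hn),
          Finset.sum_congr rfl fun n hn => if_pos (Finset.mem_range.mp hn)]
        ring

theorem sum_ofReal_mul_val_le_of_isEnvelope (hsymm : M.IsSymmetric)
    (hmono : M.IsMonotone) {N L : ℕ} {d : Fin N → WeightedTuple K I} {ω κ : ℝ} {X : ℕ → ℝ}
    (hX : IsEnvelope d (fun k => (k + 1) * (L * ω)) ω κ X) (hXI : ∀ j, X j ∈ I) (hω : 0 < ω)
    (hωK : ω ∈ K) :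
    ∑ k, ENNReal.ofReal (L * ω * M.val (d k)) ≤
      ∑ n ∈ Finset.range (N * L), ENNReal.ofReal (ω * M.prefixMean X (fun _ => ω) n) := by
  have hsplit (k : Fin N) : ENNReal.ofReal (L * ω * M.val (d k)) =
      ∑ _ : Fin L, ENNReal.ofReal (ω * M.val (d k)) := by
    rw [Finset.sum_const, Finset.card_univ, Fintype.card_fin, nsmul_eq_mul, mul_assoc,
      ENNReal.ofReal_mul L.cast_nonneg, ENNReal.ofReal_natCast]
  have hblock (j : Fin (N * L)) : ((j : ℝ) + 1) * ω ≤ (j.divNat + 1) * (L * ω) := by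
    have hL : 0 < L := pos_of_mul_pos_right (j.val.zero_le.trans_lt j.isLt) N.zero_le
    rw [← mul_assoc]
    refine mul_le_mul_of_nonneg_right ?_ hω.le
    exact_mod_cast (Nat.lt_mul_div_succ j hL).trans_eq (mul_comm L _)
  calc ∑ k, ENNReal.ofReal (L * ω * M.val (d k))
      = ∑ q : Fin N × Fin L, ENNReal.ofReal (ω * M.val (d q.1)) := by
        simp only [hsplit, Fintype.sum_prod_type]
    _ = ∑ j : Fin (N * L), ENNReal.ofReal (ω * M.val (d j.divNat)) :=
        (Equiv.sum_comp finProdFinEquiv.symm fun q => ENNReal.ofReal (ω * M.val (d q.1))).symm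
    _ ≤ ∑ j : Fin (N * L), ENNReal.ofReal (ω * M.prefixMean X (fun _ => ω) j) := by
        gcongr with j
        exact hX.val_le_prefixMean hsymm hmono hXI hω hωK j.divNat (hblock j)
    _ = ∑ n ∈ Finset.range (N * L), ENNReal.ofReal (ω * M.prefixMean X (fun _ => ω) n) :=
        (Finset.sum_range fun n => ENNReal.ofReal (ω * M.prefixMean X (fun _ => ω) n)).symm

theorem IsHardyBound.sum_ofReal_mul_val_le (hC : M.IsHardyBound C) (hC' : C ≠ ∞)
    (hI : I.OrdConnected) (hI0 : IsGLB I 0) (hsymm : M.IsSymmetric) (hmono : M.IsMonotone)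
    (hm : Measurable m) {τ ε : ℝ} (hτ : 0 < τ) (hτK : τ ∈ K) {N : ℕ}
    (d : Fin N → WeightedTuple K I)
    (hd : ∀ k : Fin N, d k ∈ excessTuples K I m ε ((k + 1) * τ)) :
    ∑ k, ENNReal.ofReal (τ * M.val (d k)) ≤ C * ((∫⁻ s in Ioi (0 : ℝ), m s) +
      ∑ k : Fin N, ENNReal.ofReal ((k + 1) * τ) * ENNReal.ofReal ε) := by
  by_cases hp : ∃ p ∈ I, 0 < p
  swap
  · have hval (k) : ENNReal.ofReal (τ * M.val (d k)) = 0 :=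
      ENNReal.ofReal_of_nonpos <| mul_nonpos_of_nonneg_of_nonpos hτ.le <|
        not_lt.mp fun h => hp ⟨_, M.val_mem (d k), h⟩
    simp [hval]
  obtain ⟨p, hpI, hp⟩ := hp
  obtain ⟨B, hB⟩ :=
    (finite_range fun q : Σ k : Fin N, Fin (d k).n => (d q.1).entry q.2).bddAbove
  refine le_of_forall_le_add_mul_one_div
    (c := C * (ENNReal.ofReal (N * τ) * ENNReal.ofReal p + ENNReal.ofReal τ * ENNReal.ofReal B))
    (by finiteness) fun q => ?_
  set δ : ℝ := 1 / ((q : ℝ) + 1)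
  have hδ : 0 < δ := by positivity
  have hδ1 : δ ≤ 1 := div_le_one_of_le₀ (le_add_of_nonneg_left q.cast_nonneg) (by positivity)
  have hω : 0 < τ * δ := mul_pos hτ hδ
  have hωK : τ * δ ∈ K := K.mul_mem hτK (one_div_natCast_add_one_mem K q)
  have hLω : (q + 1 : ℕ) * (τ * δ) = τ := by
    simp only [δ, Nat.cast_add_one]
    field_simp
  have hℓ (k : Fin N) : 0 < ((k : ℝ) + 1) * ((q + 1 : ℕ) * (τ * δ)) := by positivity
  obtain ⟨X, hXI, hX⟩ := exists_isEnvelope d hℓ hω.le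
    (mem_of_pos_of_le hI hI0 hpI (mul_pos hp hδ) (mul_le_of_le_one_right hp.le hδ1))
  calc ∑ k, ENNReal.ofReal (τ * M.val (d k))
      ≤ ∑ n ∈ Finset.range (N * (q + 1)),
          ENNReal.ofReal (τ * δ * M.prefixMean X (fun _ => τ * δ) n) := by
        simpa only [hLω] using
          sum_ofReal_mul_val_le_of_isEnvelope hsymm hmono hX hXI hω hωK
    _ ≤ C * ∑ n ∈ Finset.range (N * (q + 1)), ENNReal.ofReal (τ * δ * X n) :=
        hC.sum_range_le hC' (fun n => ⟨hXI n, (mul_pos hp hδ).trans_le (hX.le_apply n)⟩)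
          (fun _ => ⟨hωK, hω⟩) _
    _ ≤ C * (ENNReal.ofReal ((N * (q + 1) : ℕ) * (τ * δ)) * ENNReal.ofReal (p * δ) +
          ENNReal.ofReal (τ * δ) * ENNReal.ofReal B +
          ((∫⁻ s in Ioi (0 : ℝ), m s) +
            ∑ k : Fin N, ENNReal.ofReal ((k + 1) * τ) * ENNReal.ofReal ε)) := by
        gcongr
        simpa only [hLω] using hX.sum_ofReal_mul_le hω hℓ (fun k i => hB ⟨⟨k, i⟩, rfl⟩) hm
          (by simpa only [hLω] using hd) (N * (q + 1))
    _ = _ := by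
        rw [Nat.cast_mul, mul_assoc, hLω, ENNReal.ofReal_mul hp.le, ENNReal.ofReal_mul hτ.le]
        ring

/-- The least upper bound of the means of the tuples that exceed the distribution `m`, which is
stretched to length `t`, only infinitesimally in the sense of `excessTuples`. -/
noncomputable def majorant (M : WeightedMean K I) (m : ℝ → ℝ≥0∞) (t : ℝ) : ℝ≥0∞ :=
  ⨅ n : ℕ, ⨆ d : excessTuples K I m (1 / (n + 1)) t, ENNReal.ofReal (M.val d)

theorem antitone_majorant (M : WeightedMean K I) (m : ℝ → ℝ≥0∞) : Antitone (M.majorant m) :=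
  fun _ _ h => iInf_mono fun _ => iSup_mono' fun d => ⟨⟨d, excessTuples_mono h d.2⟩, le_rfl⟩

theorem toENNReal_upper_le_majorant (M : WeightedMean K I) {f : ℝ → ℝ} {t : ℝ} (ht : 0 < t)
    (hf : IntegrableOn f (Ico 0 t)) : (M.upper 0 t f).toENNReal ≤
      M.majorant (fun s => volume {u | u ∈ Ici (0 : ℝ) ∧ s < f u}) t := by
  refine le_iInf fun n => ?_
  set S := ⨆ d : excessTuples K I _ (1 / ((n : ℝ) + 1)) t, ENNReal.ofReal (M.val d)
  suffices h : M.upper 0 t f ≤ S by simpa using EReal.toENNReal_le_toENNReal h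
  refine (iInf_le _ ⟨1 / ((n : ℝ) + 1), by positivity⟩).trans (iSup₂_le fun g hg => ?_)
  calc (M.simple g : EReal) ≤ (ENNReal.ofReal (M.val g.tuple) : EReal) := by
        rw [M.simple_eq_val, EReal.coe_ennreal_ofReal]
        exact EReal.coe_le_coe_iff.mpr (le_max_left _ _)
    _ ≤ S := EReal.coe_ennreal_le_coe_ennreal_iff.mpr <|
        le_iSup (fun d : excessTuples K I _ _ t => ENNReal.ofReal (M.val d))
          ⟨g.tuple, tuple_mem_excessTuples ht hf hg⟩

end WeightedMean

theorem sum_iSup_eq_iSup_pi {ι : Type*} [Fintype ι] {α : ι → Type*} [∀ i, Nonempty (α i)]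
    (F : ∀ i, α i → ℝ≥0∞) : ∑ i, ⨆ a, F i a = ⨆ a : ∀ i, α i, ∑ i, F i (a i) := by
  classical
  rw [← ENNReal.finsetSum_iSup]
  · exact Finset.sum_congr rfl fun i _ => ((Function.surjective_eval i).iSup_comp (F i)).symm
  · intro a b
    refine ⟨fun i => if F i (a i) ≤ F i (b i) then b i else a i, fun i => ?_⟩
    grind

theorem setLIntegral_Ioi_le_tsum_of_antitone {V : ℝ → ℝ≥0∞} (hV : Antitone V) {τ : ℝ}
    (hτ : 0 < τ) : ∫⁻ t in Ioi τ, V t ≤ ∑' k : ℕ, ENNReal.ofReal τ * V ((k + 1) * τ) := by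
  have hcover : ⋃ k : ℕ, Ioc ((k + 1) * τ) ((↑(k + 1) + 1) * τ) = Ioi τ := by
    have hbot (k : ℕ) : (((⊥ : ℕ) : ℝ) + 1) * τ ≤ ((k : ℝ) + 1) * τ := by
      gcongr
      exact bot_le
    have htop : Filter.Tendsto (fun k : ℕ => ((k : ℝ) + 1) * τ) Filter.atTop Filter.atTop :=
      (Filter.tendsto_atTop_add_const_right _ 1 tendsto_natCast_atTop_atTop).atTop_mul_const hτ
    simpa using iUnion_Ioc_map_succ_eq_Ioi (f := fun k : ℕ => ((k : ℝ) + 1) * τ) hbot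
      (Filter.not_bddAbove_of_tendsto_atTop htop)
  rw [← hcover]
  refine (lintegral_iUnion_le _ _).trans (ENNReal.tsum_le_tsum fun k => ?_)
  calc ∫⁻ t in Ioc ((k + 1) * τ) ((↑(k + 1) + 1) * τ), V t
      ≤ ∫⁻ t in Ioc ((k + 1) * τ) ((↑(k + 1) + 1) * τ), V ((k + 1) * τ) :=
        setLIntegral_mono' measurableSet_Ioc fun t ht => hV ht.1.le
    _ = ENNReal.ofReal τ * V ((k + 1) * τ) := by
        rw [setLIntegral_const, Real.volume_Ioc, mul_comm]
        push_cast
        ring_nf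

namespace WeightedMean

variable {M : WeightedMean K I} {C : ℝ≥0∞} {m : ℝ → ℝ≥0∞}

theorem IsHardyBound.sum_majorant_le (hC : M.IsHardyBound C) (hC' : C ≠ ∞)
    (hI : I.OrdConnected) (hI0 : IsGLB I 0) (hsymm : M.IsSymmetric) (hmono : M.IsMonotone)
    (hm : Measurable m) {τ : ℝ} (hτ : 0 < τ) (hτK : τ ∈ K) (N : ℕ) :
    ∑ k : Fin N, ENNReal.ofReal τ * M.majorant m ((k + 1) * τ) ≤
      C * ∫⁻ s in Ioi (0 : ℝ), m s := by
  refine le_of_forall_le_add_mul_one_div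
    (c := C * ∑ k : Fin N, ENNReal.ofReal ((k + 1) * τ))
    (ENNReal.mul_ne_top hC' (ENNReal.sum_ne_top.mpr fun _ _ => ENNReal.ofReal_ne_top)) fun n => ?_
  have hnonempty (k : Fin N) :
      Nonempty (excessTuples K I m (1 / ((n : ℝ) + 1)) ((k + 1) * τ)) :=
    (excessTuples_nonempty hI0 m (by positivity) _).to_subtype
  calc ∑ k : Fin N, ENNReal.ofReal τ * M.majorant m ((k + 1) * τ)
      ≤ ∑ k : Fin N, ⨆ d : excessTuples K I m (1 / ((n : ℝ) + 1)) ((k + 1) * τ),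
          ENNReal.ofReal (τ * M.val d) := by
        simp only [ENNReal.ofReal_mul hτ.le, ← ENNReal.mul_iSup]
        gcongr
        exact iInf_le _ n
    _ ≤ C * ((∫⁻ s in Ioi (0 : ℝ), m s) +
          ∑ k : Fin N, ENNReal.ofReal ((k + 1) * τ) * ENNReal.ofReal (1 / ((n : ℝ) + 1))) := by
        rw [sum_iSup_eq_iSup_pi]
        exact iSup_le fun d => hC.sum_ofReal_mul_val_le hC' hI hI0 hsymm hmono hm hτ hτK
          (fun k => d k) fun k => (d k).2
    _ = _ := by rw [← Finset.sum_mul, mul_add, mul_assoc]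

theorem IsHardyBound.lintegral_majorant_le (hC : M.IsHardyBound C) (hC' : C ≠ ∞)
    (hI : I.OrdConnected) (hI0 : IsGLB I 0) (hsymm : M.IsSymmetric) (hmono : M.IsMonotone)
    (hm : Measurable m) :
    ∫⁻ t in Ioi (0 : ℝ), M.majorant m t ≤ C * ∫⁻ s in Ioi (0 : ℝ), m s := by
  have hcover : Ioi (0 : ℝ) = ⋃ q : ℕ, Ioi (1 / ((q : ℝ) + 1)) := by
    ext t
    simp only [mem_iUnion, mem_Ioi]
    exact ⟨fun h => exists_nat_one_div_lt h,
      fun ⟨_, hq⟩ => Nat.one_div_pos_of_nat.trans hq⟩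
  have hdirected : Monotone fun q : ℕ => Ioi (1 / ((q : ℝ) + 1)) := fun _ _ h =>
    Ioi_subset_Ioi (Nat.one_div_le_one_div h)
  conv_lhs => rw [hcover]
  rw [setLIntegral_iUnion_of_directed _ hdirected.directed_le]
  refine iSup_le fun q =>
    (setLIntegral_Ioi_le_tsum_of_antitone (M.antitone_majorant m) (by positivity)).trans ?_
  rw [ENNReal.tsum_eq_iSup_nat]
  refine iSup_le fun N => ?_
  rw [Finset.sum_range]
  exact hC.sum_majorant_le hC' hI hI0 hsymm hmono hm (by positivity)
    (one_div_natCast_add_one_mem K q) N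

theorem IsHardyBound.lintegral_upper_le (hC : M.IsHardyBound C) (hC' : C ≠ ∞)
    (hI : I.OrdConnected) (hI0 : IsGLB I 0) (hsymm : M.IsSymmetric) (hmono : M.IsMonotone)
    {f : ℝ → ℝ} (hfI : MapsTo f (Ici 0) I) (hf : IntegrableOn f (Ici 0)) :
    ∫⁻ t in Ioi (0 : ℝ), (M.upper 0 t f).toENNReal ≤
      C * ∫⁻ t in Ioi (0 : ℝ), ENNReal.ofReal (f t) := by
  let m (s : ℝ) : ℝ≥0∞ := volume {u | u ∈ Ici (0 : ℝ) ∧ s < f u}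
  have hm : Measurable m := Antitone.measurable fun _ _ h =>
    measure_mono fun _ hu => ⟨hu.1, h.trans_lt hu.2⟩
  have hlayer : ∫⁻ s in Ioi (0 : ℝ), m s = ∫⁻ t in Ioi (0 : ℝ), ENNReal.ofReal (f t) := by
    rw [setLIntegral_congr (f := fun t => ENNReal.ofReal (f t)) Ioi_ae_eq_Ici,
      lintegral_eq_lintegral_meas_lt _
        (ae_restrict_of_forall_mem measurableSet_Ici fun t ht => hI0.1 (hfI ht))
        hf.aestronglyMeasurable.aemeasurable]
    refine lintegral_congr fun s => ?_
    rw [Measure.restrict_apply' measurableSet_Ici, inter_comm]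
    rfl
  calc ∫⁻ t in Ioi (0 : ℝ), (M.upper 0 t f).toENNReal
      ≤ ∫⁻ t in Ioi (0 : ℝ), M.majorant m t := setLIntegral_mono' measurableSet_Ioi fun t ht =>
        M.toENNReal_upper_le_majorant ht (hf.mono_set Ico_subset_Ici_self)
    _ ≤ C * ∫⁻ s in Ioi (0 : ℝ), m s := hC.lintegral_majorant_le hC' hI hI0 hsymm hmono hm
    _ = C * ∫⁻ t in Ioi (0 : ℝ), ENNReal.ofReal (f t) := by rw [hlayer]

end WeightedMean

theorem integralHardyConst_upper_le_hardyConst {M : WeightedMean K I} (hI : I.OrdConnected)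
    (hI0 : IsGLB I 0) (hsymm : M.IsSymmetric) (hmono : M.IsMonotone) :
    integralHardyConst I M.upper ≤ M.hardyConst := by
  refine le_sInf fun C (hC : M.IsHardyBound C) => ?_
  by_cases hC' : C = ∞
  · exact hC' ▸ le_top
  · exact sInf_le fun f hfI hf _ => hC.lintegral_upper_le hC' hI hI0 hsymm hmono hfI hf

theorem integralHardyConst_lower_le_upper {M : WeightedMean K I} (hI : I.OrdConnected) :
    integralHardyConst I M.lower ≤ integralHardyConst I M.upper :=
  le_sInf fun _ hC => sInf_le fun f hfI hf hD =>
    (setLIntegral_mono' measurableSet_Ioi fun _ ht => EReal.toENNReal_le_toENNReal <|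
      M.lower_le_upper hI ht (hf.mono_set Ico_subset_Ici_self)
        (hfI.mono_left Ico_subset_Ici_self)).trans (hC f hfI hf hD)

theorem integralHardyConstOn_ext_le_lower {M : WeightedMean K I} :
    integralHardyConstOn I M.ExtDefined M.ext ≤ integralHardyConst I M.lower :=
  le_sInf fun _ hC => sInf_le fun f hfI hf _ => hC f hfI hf (.of_forall fun _ => trivial)

/-! ### Means of continuous functions -/

theorem volume_superlevel_mono {f₁ f₂ : ℝ → ℝ} {s₁ s₂ : ℝ}
    (h : ∀ u ∈ Ico (0 : ℝ) 1, s₁ < f₁ u → s₂ < f₂ u) :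
    volume (superlevel f₁ s₁) ≤ volume (superlevel f₂ s₂) :=
  measure_mono fun u hu => ⟨hu.1, h u hu.1 hu.2⟩

theorem volume_superlevel_add_le (f₁ f₂ : ℝ → ℝ) (s c : ℝ) :
    volume (superlevel f₁ (s + c)) ≤
      volume (superlevel f₂ s) + volume {u | u ∈ Ico (0 : ℝ) 1 ∧ c ≤ |f₁ u - f₂ u|} := by
  refine (measure_mono fun u hu => ?_).trans (measure_union_le _ _)
  by_cases hs : s < f₂ u
  · exact .inl ⟨hu.1, hs⟩
  · exact .inr ⟨hu.1, by linarith [hu.2, le_abs_self (f₁ u - f₂ u)]⟩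

theorem volume_le_abs_sub_le {f : ℝ → ℝ} (hf : AEMeasurable f (volume.restrict (Ico 0 1)))
    {ε c : ℝ} (hc : 0 < c) {g : SimpleFn K I} (hg : g ∈ nhdSimple K I ε f) :
    volume {u | u ∈ Ico (0 : ℝ) 1 ∧ c ≤ |f u - g.toFun u|} ≤ ENNReal.ofReal (ε / c) := by
  have hmarkov := mul_meas_ge_le_lintegral₀
    (hf.sub g.measurable_toFun.aemeasurable).abs.ennreal_ofReal (ENNReal.ofReal c)
  rw [Measure.restrict_apply' measurableSet_Ico] at hmarkov
  rw [ENNReal.ofReal_div_of_pos hc, ENNReal.le_div_iff_mul_le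
    (.inl (ENNReal.ofReal_pos.mpr hc).ne') (.inl ENNReal.ofReal_ne_top), mul_comm]
  refine (mul_le_mul_right (measure_mono fun u hu => ?_) _).trans (hmarkov.trans hg.2.le)
  exact ⟨ENNReal.ofReal_le_ofReal hu.2, hu.1⟩

theorem exists_volume_superlevel_gap {f : ℝ → ℝ} (hf : ContinuousOn f (Icc 0 1)) {η : ℝ}
    (hη : 0 < η) :
    ∃ δ > 0, ∀ s, (∃ u ∈ Ico (0 : ℝ) 1, s + η < f u) → (∃ v ∈ Ico (0 : ℝ) 1, f v ≤ s) →
      volume (superlevel f (s + η)) + ENNReal.ofReal δ ≤ volume (superlevel f s) := by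
  obtain ⟨δ, hδ, hfδ⟩ := Metric.uniformContinuousOn_iff.mp
    (isCompact_Icc.uniformContinuousOn_of_continuous hf) (η / 2) (half_pos hη)
  refine ⟨δ, hδ, fun s ⟨u, hu, hfu⟩ ⟨v, hv, hfv⟩ => ?_⟩
  have huv : uIcc u v ⊆ Ico 0 1 := ordConnected_Ico.uIcc_subset hu hv
  obtain ⟨m, hm, hfm⟩ := intermediate_value_uIcc (hf.mono (huv.trans Ico_subset_Icc_self))
    (show s + η / 2 ∈ uIcc (f u) (f v) from mem_uIcc.mpr (.inr ⟨by linarith, by linarith⟩))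
  have hnear (z) (hz : z ∈ Ico (0 : ℝ) 1) (hzm : |z - m| < δ) : s < f z ∧ f z < s + η := by
    have h := abs_lt.mp (hfδ z (Ico_subset_Icc_self hz) m (Ico_subset_Icc_self (huv hm)) hzm)
    grind
  have hfar_u : δ ≤ |u - m| := by
    by_contra! hlt
    exact (hnear u hu hlt).2.not_gt hfu
  have hfar_v : δ ≤ |v - m| := by
    by_contra! hlt
    exact (hnear v hv hlt).1.not_ge hfv
  have hIoo (z) (hz : z ∈ Ioo m (m + δ)) : z ∈ Ico (0 : ℝ) 1 ∧ s < f z ∧ f z < s + η := by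
    have hz' : z ∈ uIcc u v := by grind [mem_uIcc]
    exact ⟨huv hz', hnear z (huv hz') (by grind)⟩
  calc volume (superlevel f (s + η)) + ENNReal.ofReal δ
      = volume (superlevel f (s + η) ∪ Ioo m (m + δ)) := by
        rw [measure_union _ measurableSet_Ioo, Real.volume_Ioo, add_sub_cancel_left]
        exact Set.disjoint_left.mpr fun z hz hz' => (hIoo z hz').2.2.not_gt hz.2
    _ ≤ volume (superlevel f s) := measure_mono <| union_subset
        (fun z hz => ⟨hz.1, (lt_add_of_pos_right s hη).trans hz.2⟩)
        fun z hz => ⟨(hIoo z hz).1, (hIoo z hz).2.1⟩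

theorem exists_volume_superlevel_le_of_mem_nhdSimple (K : Subfield ℝ) (I : Set ℝ) {f : ℝ → ℝ}
    (hf : ContinuousOn f (Icc 0 1)) {η : ℝ} (hη : 0 < η) :
    ∃ ε > 0, ∀ g ∈ nhdSimple K I ε f, ∀ s,
      volume (superlevel f (s + η)) ≤ volume (superlevel g.toFun s) ∧
      volume (superlevel g.toFun (s + η)) ≤ volume (superlevel f s) := by
  obtain ⟨δ, hδ, hgap⟩ := exists_volume_superlevel_gap hf (half_pos hη)
  refine ⟨min (δ * (η / 2)) (η / 8), by positivity, fun g hg s => ?_⟩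
  have hεη : min (δ * (η / 2)) (η / 8) ≤ η / 8 := min_le_right _ _
  have hclose : volume {u | u ∈ Ico (0 : ℝ) 1 ∧ η / 2 ≤ |f u - g.toFun u|} ≤ ENNReal.ofReal δ :=
    (volume_le_abs_sub_le ((hf.mono Ico_subset_Icc_self).aemeasurable measurableSet_Ico)
      (half_pos hη) hg).trans (ENNReal.ofReal_le_ofReal
        ((div_le_iff₀ (half_pos hη)).mpr (min_le_left _ _)))
  have hsplit : s + η = s + η / 2 + η / 2 := by ring
  rw [hsplit]
  constructor
  · by_cases hu : ∃ u ∈ Ico (0 : ℝ) 1, s + η / 2 + η / 2 < f u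
    swap
    · push Not at hu
      rw [superlevel_eq_empty hu, measure_empty]
      exact zero_le
    by_cases hv : ∃ v ∈ Ico (0 : ℝ) 1, f v ≤ s + η / 2
    · rw [← ENNReal.add_le_add_iff_right (ENNReal.ofReal_ne_top (r := δ))]
      exact (hgap _ hu hv).trans ((volume_superlevel_add_le f g.toFun s _).trans (by gcongr))
    · push Not at hv
      exact volume_superlevel_mono fun u hu _ => by
        linarith [le_toFun_of_mem_nhdSimple hg (fun v hv' => (hv v hv').le) hu]
  · by_cases hv : ∃ v ∈ Ico (0 : ℝ) 1, f v ≤ s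
    swap
    · push Not at hv
      exact volume_superlevel_mono fun u hu _ => hv u hu
    by_cases hu : ∃ u ∈ Ico (0 : ℝ) 1, s + η / 2 < f u
    · refine (volume_superlevel_add_le g.toFun f (s + η / 2) _).trans (le_trans ?_ (hgap s hu hv))
      simp only [abs_sub_comm (g.toFun _)]
      gcongr
    · push Not at hu
      rw [superlevel_eq_empty fun u hu' => (toFun_le_of_mem_nhdSimple hg hu hu').trans
        (by linarith), measure_empty]
      exact zero_le

/-- The distribution of the tuple lies below that of `f` on `[0, 1)`, even when `f` is lowered by
some positive constant. -/
def WeightedTuple.LiesBelow (d : WeightedTuple K I) (f : ℝ → ℝ) : Prop :=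
  ∃ η > 0, ∀ s, ENNReal.ofReal (d.tail s) ≤ volume (superlevel f (s + η))

/-- The distribution of the tuple lies above that of `f` on `[0, 1)`, even when `f` is raised by
some positive constant. -/
def WeightedTuple.LiesAbove (d : WeightedTuple K I) (f : ℝ → ℝ) : Prop :=
  ∃ η > 0, ∀ s, volume (superlevel f s) ≤ ENNReal.ofReal (d.tail (s + η))

namespace WeightedMean

/-- The supremum of the means of the tuples below `f`: a lower bound for the lower mean of a
continuous `f` on `[0, 1)` that, unlike the lower mean, is obviously monotone in `f`. -/
noncomputable def innerMean (M : WeightedMean K I) (f : ℝ → ℝ) : EReal :=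
  ⨆ d : WeightedTuple K I, ⨆ _ : d.LiesBelow f, (M.val d : EReal)

/-- The infimum of the means of the tuples above `f`: an upper bound for the upper mean of a
continuous `f` on `[0, 1)`. -/
noncomputable def outerMean (M : WeightedMean K I) (f : ℝ → ℝ) : EReal :=
  ⨅ d : WeightedTuple K I, ⨅ _ : d.LiesAbove f, (M.val d : EReal)

variable (M : WeightedMean K I) {f f₁ f₂ : ℝ → ℝ}

theorem innerMean_mono (h : ∀ u ∈ Ico (0 : ℝ) 1, f₁ u ≤ f₂ u) :
    M.innerMean f₁ ≤ M.innerMean f₂ :=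
  iSup_mono fun _ => iSup_mono' fun ⟨η, hη, hd⟩ => ⟨⟨η, hη, fun s => (hd s).trans
    (volume_superlevel_mono fun u hu hs => hs.trans_le (h u hu))⟩, le_rfl⟩

theorem outerMean_mono (h : ∀ u ∈ Ico (0 : ℝ) 1, f₁ u ≤ f₂ u) :
    M.outerMean f₁ ≤ M.outerMean f₂ :=
  iInf_mono fun _ => iInf_mono' fun ⟨η, hη, hd⟩ => ⟨⟨η, hη, fun s =>
    (volume_superlevel_mono fun u hu hs => hs.trans_le (h u hu)).trans (hd s)⟩, le_rfl⟩

theorem outerMean_le_innerMean (hI : I.OrdConnected) (hf₁ : ContinuousOn f₁ (Icc 0 1))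
    (hf₂ : ContinuousOn f₂ (Icc 0 1)) (h₁ : MapsTo f₁ (Ico 0 1) I) (h₂ : MapsTo f₂ (Ico 0 1) I)
    {η : ℝ} (hη : 0 < η) (h : ∀ u ∈ Ico (0 : ℝ) 1, f₁ u + η ≤ f₂ u) :
    M.outerMean f₁ ≤ M.innerMean f₂ := by
  obtain ⟨g, hg⟩ := exists_simpleFn_near (I := I) K (φ := fun u => (f₁ u + f₂ u) / 2)
    ((hf₁.add hf₂).div_const 2)
    (fun u hu => hI.out (h₁ hu) (h₂ hu) ⟨by linarith [h u hu], by linarith [h u hu]⟩)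
    (show 0 < η / 4 by positivity)
  have hfar (u) (hu : u ∈ Ico (0 : ℝ) 1) : f₁ u + η / 4 ≤ g.toFun u ∧ g.toFun u + η / 4 ≤ f₂ u := by
    have hgu := abs_le.mp (hg u hu).2
    have := h u hu
    constructor <;> linarith
  have habove : g.tuple.LiesAbove f₁ := ⟨η / 4, by positivity, fun s => by
    rw [← g.volume_superlevel]
    exact volume_superlevel_mono fun u hu hs => by linarith [(hfar u hu).1]⟩
  have hbelow : g.tuple.LiesBelow f₂ := ⟨η / 8, by positivity, fun s => by
    rw [← g.volume_superlevel]
    exact volume_superlevel_mono fun u hu hs => by linarith [(hfar u hu).2]⟩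
  exact iInf₂_le_of_le g.tuple habove (le_iSup₂_of_le g.tuple hbelow le_rfl)

variable {M} {a b : ℝ}

theorem innerMean_le_lower (hsymm : M.IsSymmetric) (hmono : M.IsMonotone)
    (hf : ContinuousOn (rescale a b f) (Icc 0 1)) :
    M.innerMean (rescale a b f) ≤ M.lower a b f := by
  refine iSup₂_le fun d ⟨η, hη, hd⟩ => ?_
  obtain ⟨ε, hε, hg⟩ := exists_volume_superlevel_le_of_mem_nhdSimple K I hf hη
  refine le_iSup_of_le ⟨ε, hε⟩ (le_iInf₂ fun g hgε => EReal.coe_le_coe_iff.mpr ?_)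
  rw [M.simple_eq_val]
  refine M.val_le_val hsymm hmono fun s => ?_
  rw [← ENNReal.ofReal_le_ofReal_iff (g.tuple.tail_nonneg s), ← g.volume_superlevel]
  exact (hd s).trans (hg g hgε s).1

theorem upper_le_outerMean (hsymm : M.IsSymmetric) (hmono : M.IsMonotone)
    (hf : ContinuousOn (rescale a b f) (Icc 0 1)) :
    M.upper a b f ≤ M.outerMean (rescale a b f) := by
  refine le_iInf₂ fun d ⟨η, hη, hd⟩ => ?_
  obtain ⟨ε, hε, hg⟩ := exists_volume_superlevel_le_of_mem_nhdSimple K I hf hη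
  refine iInf_le_of_le ⟨ε, hε⟩ (iSup₂_le fun g hgε => EReal.coe_le_coe_iff.mpr ?_)
  rw [M.simple_eq_val]
  refine M.val_le_val hsymm hmono fun s => ?_
  have hs := (hg g hgε (s - η)).2.trans (hd (s - η))
  rw [sub_add_cancel, g.volume_superlevel] at hs
  exact (ENNReal.ofReal_le_ofReal_iff (d.tail_nonneg s)).mp hs

end WeightedMean

theorem exists_ae_le_of_forall_lt {β : Type*} [LinearOrder β] [TopologicalSpace β]
    [OrderTopology β] [SecondCountableTopology β] {L U : ℝ → ℝ → β} {a b : ℝ} (hab : a < b)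
    (hL_mono : ∀ t, Monotone fun r => L r t) (hL : ∀ r ∈ Ioo a b, Antitone (L r))
    (hU : ∀ r ∈ Ioo a b, Antitone (U r))
    (hUL : ∀ r ∈ Ioo a b, ∀ r' ∈ Ioo r b, ∀ t > 0, U r t ≤ L r' t) :
    ∃ r ∈ Ioo a b, ∀ᵐ t ∂volume.restrict (Ioi (0 : ℝ)), U r t ≤ L r t := by
  have hbad : (⋃ q : ℚ, {r | ¬ContinuousAt (fun r => L r q) r}).Countable :=
    countable_iUnion fun q => (hL_mono q).countable_not_continuousAt
  obtain ⟨r, hr, hrab⟩ := (hbad.dense_compl ℝ).exists_mem_open isOpen_Ioo (nonempty_Ioo.mpr hab)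
  simp only [mem_compl_iff, mem_iUnion, mem_ofPred_eq, not_exists, not_not] at hr
  have hrat (q : ℚ) (hq : (0 : ℝ) < q) : U r q ≤ L r q := by
    refine ge_of_tendsto ((hr q).tendsto.mono_left (nhdsWithin_le_nhds (s := Ioi r))) ?_
    filter_upwards [Ioo_mem_nhdsGT hrab.2] with r' hr'
    exact hUL r hrab r' hr' q hq
  refine ⟨r, hrab, ?_⟩
  filter_upwards [(hL r hrab).countable_not_continuousAt.ae_notMem (volume.restrict (Ioi 0)),
    ae_restrict_mem measurableSet_Ioi] with t ht ht0
  refine ge_of_tendsto ((not_not.mp ht).tendsto.mono_left (nhdsWithin_le_nhds (s := Iio t))) ?_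
  filter_upwards [Ioo_mem_nhdsLT ht0] with t' ht'
  obtain ⟨q, ht'q, hqt⟩ := exists_rat_btwn ht'.2
  exact (hU r hrab hqt.le).trans ((hrat q (ht'.1.trans ht'q)).trans (hL r hrab ht'q.le))

theorem rescale_zero_left (t : ℝ) (f : ℝ → ℝ) : rescale 0 t f = fun u => f (u * t) := by
  funext u
  rw [rescale, zero_add, sub_zero]

/-- The outer mean of `r * F` is at most the inner mean of `r' * F` for `r < r'`, and the latter
has only countably many jumps, so that `r` can be chosen where the two agree. -/
theorem exists_extDefined {M : WeightedMean K I} (hI : I.OrdConnected) (hI0 : IsGLB I 0)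
    (hsymm : M.IsSymmetric) (hmono : M.IsMonotone) {F : ℝ → ℝ} (hF : Continuous F)
    (hF_anti : Antitone F) (hF_pos : ∀ t, 0 < F t) (hF_int : IntegrableOn F (Ici 0)) {c : ℝ}
    (hc : c ∈ I) (hFc : ∀ t, F t ≤ c) {r₀ : ℝ} (hr₀ : 0 ≤ r₀) (hr₀1 : r₀ < 1) :
    ∃ r ∈ Ioo r₀ 1, ∀ᵐ t ∂volume.restrict (Ioi (0 : ℝ)), M.ExtDefined 0 t fun v => r * F v := by
  have hmem (r) (hr : r ∈ Ioo r₀ 1) (v : ℝ) : r * F v ∈ I :=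
    mem_of_pos_of_le hI hI0 hc (mul_pos (hr₀.trans_lt hr.1) (hF_pos v))
      ((mul_le_of_le_one_left (hF_pos v).le hr.2.le).trans (hFc v))
  have hanti (r) (hr : r ∈ Ioo r₀ 1) {t t' : ℝ} (htt' : t ≤ t') (u) (hu : u ∈ Ico (0 : ℝ) 1) :
      r * F (u * t') ≤ r * F (u * t) :=
    mul_le_mul_of_nonneg_left (hF_anti (mul_le_mul_of_nonneg_left htt' hu.1))
      (hr₀.trans hr.1.le)
  obtain ⟨r, hr, hUL⟩ := exists_ae_le_of_forall_lt hr₀1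
    (L := fun r t => M.innerMean fun u => r * F (u * t))
    (U := fun r t => M.outerMean fun u => r * F (u * t))
    (fun t r r' hrr' => M.innerMean_mono fun u _ => mul_le_mul_of_nonneg_right hrr' (hF_pos _).le)
    (fun r hr t t' htt' => M.innerMean_mono (hanti r hr htt'))
    (fun r hr t t' htt' => M.outerMean_mono (hanti r hr htt'))
    (fun r hr r' hr' t ht => by
      refine M.outerMean_le_innerMean hI (by fun_prop) (by fun_prop) (fun u _ => hmem r hr _)
        (fun u _ => hmem r' ⟨hr.1.trans hr'.1, hr'.2⟩ _)
        (mul_pos (sub_pos.mpr hr'.1) (hF_pos t)) fun u hu => ?_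
      have hFt : F t ≤ F (u * t) := hF_anti (mul_le_of_le_one_left ht.le hu.2.le)
      nlinarith [hr'.1])
  refine ⟨r, hr, ?_⟩
  filter_upwards [hUL, ae_restrict_mem measurableSet_Ioi] with t ht ht0
  have hcont : ContinuousOn (rescale 0 t fun v => r * F v) (Icc 0 1) := by
    rw [rescale_zero_left]
    fun_prop
  refine le_antisymm (M.lower_le_upper hI ht0 ((hF_int.mono_set Ico_subset_Ici_self).const_mul r)
    fun v _ => hmem r hr v) ?_
  refine (WeightedMean.upper_le_outerMean hsymm hmono hcont).trans (le_trans ?_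
    (WeightedMean.innerMean_le_lower hsymm hmono hcont))
  rwa [rescale_zero_left]

/-! ### From the integral to the discrete inequality -/

/-- A continuous substitute, with values in `(0, c]`, for the generalized inverse of a decreasing
function `T`: the indicator of `v ≤ T s` in the layer cake formula for that inverse is replaced by
`exp (min 0 ((T s - v) / δ))`. -/
noncomputable def smoothInverse (T : ℝ → ℝ) (c δ v : ℝ) : ℝ :=
  ∫ s in Ioc 0 c, Real.exp (min 0 ((T s - v) / δ))

section smoothInverse

variable {T : ℝ → ℝ} {c δ : ℝ}

theorem exp_min_zero_le_one (z : ℝ) : Real.exp (min 0 z) ≤ 1 :=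
  Real.exp_le_one_iff.mpr (min_le_left _ _)

theorem measurable_exp_min_zero_sub (hT : Measurable T) :
    Measurable fun p : ℝ × ℝ => Real.exp (min 0 ((T p.1 - p.2) / δ)) :=
  Real.measurable_exp.comp
    (measurable_const.min (((hT.comp measurable_fst).sub measurable_snd).div_const δ))

theorem integrableOn_exp_min_zero_sub (hT : Measurable T) (v : ℝ) :
    IntegrableOn (fun s => Real.exp (min 0 ((T s - v) / δ))) (Ioc 0 c) := by
  refine Measure.integrableOn_of_bounded (M := 1) (by simp)
    ((measurable_exp_min_zero_sub hT).comp measurable_prodMk_right).aestronglyMeasurable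
    (.of_forall fun s => ?_)
  rw [Real.norm_of_nonneg (Real.exp_pos _).le]
  exact exp_min_zero_le_one _

theorem continuous_smoothInverse (hT : Measurable T) : Continuous (smoothInverse T c δ) := by
  refine continuous_of_dominated (bound := fun _ => 1)
    (fun v => (integrableOn_exp_min_zero_sub hT v).aestronglyMeasurable)
    (fun v => .of_forall fun s => ?_) (by simp) (.of_forall fun s => by fun_prop)
  rw [Real.norm_of_nonneg (Real.exp_pos _).le]
  exact exp_min_zero_le_one _

theorem antitone_smoothInverse (hT : Measurable T) (hδ : 0 ≤ δ) :
    Antitone (smoothInverse T c δ) := fun v v' hvv' =>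
  integral_mono (integrableOn_exp_min_zero_sub hT v') (integrableOn_exp_min_zero_sub hT v)
    fun s => by dsimp only; gcongr

theorem smoothInverse_pos (hT : Measurable T) (hc : 0 < c) (v : ℝ) :
    0 < smoothInverse T c δ v := by
  rw [smoothInverse, integral_pos_iff_support_of_nonneg (fun s => (Real.exp_pos _).le)
    (integrableOn_exp_min_zero_sub hT v),
    Function.support_eq_univ fun s => (Real.exp_pos _).ne']
  simpa using hc

theorem smoothInverse_le (hT : Measurable T) (hc : 0 ≤ c) (v : ℝ) :
    smoothInverse T c δ v ≤ c :=
  calc smoothInverse T c δ v ≤ ∫ _ in Ioc 0 c, (1 : ℝ) :=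
        integral_mono (integrableOn_exp_min_zero_sub hT v) (by simp) fun s => exp_min_zero_le_one _
    _ = c := by simp [hc]

theorem le_smoothInverse (hT : Antitone T) (hδ : 0 ≤ δ) {s v : ℝ} (hs : s ∈ Icc 0 c)
    (hv : v ≤ T s) : s ≤ smoothInverse T c δ v :=
  calc s = ∫ _ in Ioc 0 s, (1 : ℝ) := by simp [hs.1]
    _ = ∫ s' in Ioc 0 s, Real.exp (min 0 ((T s' - v) / δ)) := by
      refine setIntegral_congr_fun measurableSet_Ioc fun s' hs' => ?_
      have : 0 ≤ T s' - v := sub_nonneg.mpr (hv.trans (hT hs'.2))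
      rw [min_eq_left (by positivity), Real.exp_zero]
    _ ≤ smoothInverse T c δ v :=
      setIntegral_mono_set (integrableOn_exp_min_zero_sub hT.measurable v)
        (.of_forall fun _ => (Real.exp_pos _).le) (Ioc_subset_Ioc_right hs.2).eventuallyLE

theorem lintegral_exp_min_zero_sub_le (a : ℝ) (hδ : 0 < δ) :
    ∫⁻ v in Ioi (0 : ℝ), ENNReal.ofReal (Real.exp (min 0 ((a - v) / δ))) ≤
      ENNReal.ofReal a + ENNReal.ofReal δ := by
  have hexp (v : ℝ) : Real.exp ((a - v) / δ) = Real.exp (a / δ) * Real.exp (-δ⁻¹ * v) := by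
    rw [← Real.exp_add]
    ring_nf
  have hint : IntegrableOn (fun v => Real.exp ((a - v) / δ)) (Ioi a) := by
    simp only [hexp]
    exact (integrableOn_exp_mul_Ioi (neg_lt_zero.mpr (inv_pos.mpr hδ)) a).const_mul _
  have htail : ∫ v in Ioi a, Real.exp ((a - v) / δ) = δ := by
    simp only [hexp]
    rw [integral_const_mul, integral_exp_mul_Ioi (neg_lt_zero.mpr (inv_pos.mpr hδ)), neg_div_neg_eq,
      ← mul_div_assoc, ← Real.exp_add, div_inv_eq_mul, show a / δ + -δ⁻¹ * a = 0 by ring,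
      Real.exp_zero, one_mul]
  have hcover : Ioi (0 : ℝ) ⊆ Ioc 0 a ∪ Ioi a := fun v hv =>
    (le_or_gt v a).imp (fun h => ⟨hv, h⟩) id
  refine (lintegral_mono_set hcover).trans ((lintegral_union_le _ _ _).trans (add_le_add ?_ ?_))
  · calc ∫⁻ v in Ioc 0 a, ENNReal.ofReal (Real.exp (min 0 ((a - v) / δ)))
        ≤ ∫⁻ _ in Ioc 0 a, 1 :=
          lintegral_mono fun v => ENNReal.ofReal_le_one.mpr (exp_min_zero_le_one _)
      _ = ENNReal.ofReal a := by simp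
  · calc ∫⁻ v in Ioi a, ENNReal.ofReal (Real.exp (min 0 ((a - v) / δ)))
        ≤ ∫⁻ v in Ioi a, ENNReal.ofReal (Real.exp ((a - v) / δ)) :=
          lintegral_mono fun v => by gcongr; exact min_le_right _ _
      _ = ENNReal.ofReal δ := by
          rw [← ofReal_integral_eq_lintegral_ofReal hint (.of_forall fun _ => (Real.exp_pos _).le),
            htail]

theorem lintegral_smoothInverse_le (hT : Measurable T) (hδ : 0 < δ) :
    ∫⁻ v in Ioi (0 : ℝ), ENNReal.ofReal (smoothInverse T c δ v) ≤
      (∫⁻ s in Ioi (0 : ℝ), ENNReal.ofReal (T s)) + ENNReal.ofReal c * ENNReal.ofReal δ :=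
  calc ∫⁻ v in Ioi (0 : ℝ), ENNReal.ofReal (smoothInverse T c δ v)
      = ∫⁻ v in Ioi (0 : ℝ), ∫⁻ s in Ioc 0 c,
          ENNReal.ofReal (Real.exp (min 0 ((T s - v) / δ))) :=
        lintegral_congr fun v => ofReal_integral_eq_lintegral_ofReal
          (integrableOn_exp_min_zero_sub hT v) (.of_forall fun _ => (Real.exp_pos _).le)
    _ = ∫⁻ s in Ioc 0 c, ∫⁻ v in Ioi (0 : ℝ),
          ENNReal.ofReal (Real.exp (min 0 ((T s - v) / δ))) :=
        (lintegral_lintegral_swap (measurable_exp_min_zero_sub hT).ennreal_ofReal.aemeasurable).symm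
    _ ≤ ∫⁻ s in Ioc 0 c, (ENNReal.ofReal (T s) + ENNReal.ofReal δ) :=
        lintegral_mono fun s => lintegral_exp_min_zero_sub_le (T s) hδ
    _ = (∫⁻ s in Ioc 0 c, ENNReal.ofReal (T s)) + ENNReal.ofReal c * ENNReal.ofReal δ := by
        rw [lintegral_add_right _ measurable_const, setLIntegral_const, Real.volume_Ioc, sub_zero,
          mul_comm]
    _ ≤ _ := by
        gcongr
        exact Ioc_subset_Ioi_self

end smoothInverse

theorem lintegral_smoothInverse_tailSum_le {n : ℕ} {x w : Fin n → ℝ} (hw : ∀ i, 0 ≤ w i)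
    {c η : ℝ} (hc : 0 ≤ c) (hη : 0 < η) :
    ∫⁻ v in Ioi (0 : ℝ),
        ENNReal.ofReal (smoothInverse (tailSum (fun i => x i + 2 * η) w) c η v) ≤
      (∑ i, ENNReal.ofReal (w i * x i)) + ENNReal.ofReal ((2 * ∑ i, w i + c) * η) := by
  refine (lintegral_smoothInverse_le (antitone_tailSum hw).measurable hη).trans ?_
  have hW : 0 ≤ ∑ i, w i := Finset.sum_nonneg fun i _ => hw i
  rw [lintegral_ofReal_tailSum hw, add_mul, ENNReal.ofReal_add (by positivity) (by positivity),
    ENNReal.ofReal_mul hc, ← add_assoc]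
  gcongr
  calc ∑ i, ENNReal.ofReal (w i * (x i + 2 * η))
      ≤ ∑ i, (ENNReal.ofReal (w i * x i) + ENNReal.ofReal (w i * (2 * η))) := by
        gcongr with i
        rw [mul_add]
        exact ENNReal.ofReal_add_le
    _ = (∑ i, ENNReal.ofReal (w i * x i)) + ENNReal.ofReal (2 * (∑ i, w i) * η) := by
        have hsum : 2 * (∑ i, w i) * η = ∑ i, w i * (2 * η) := by
          rw [← Finset.sum_mul]
          ring
        rw [Finset.sum_add_distrib, hsum, ENNReal.ofReal_sum_of_nonneg fun i _ =>
          mul_nonneg (hw i) (by positivity)]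

theorem add_lt_mul_smoothInverse {n : ℕ} {x w : Fin n → ℝ} (hx : ∀ i, 0 < x i)
    (hw : ∀ i, 0 ≤ w i) {c η r : ℝ} (hη : 0 < η) (hxc : ∀ i, x i + 2 * η ≤ c)
    (hr : (c + η) / (c + 2 * η) < r) {s v : ℝ} (hv0 : 0 ≤ v) (hv : v < tailSum x w s) :
    s + η < r * smoothInverse (tailSum (fun i => x i + 2 * η) w) c η v := by
  obtain ⟨i, hi, -⟩ := Finset.exists_ne_zero_of_sum_ne_zero (hv0.trans_lt hv).ne'
  have hsx : s < x i := (Finset.mem_filter.mp hi).2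
  have hxi := hx i
  have hxci := hxc i
  set s' := max s 0
  have hss' : s ≤ s' := le_max_left _ _
  have hs'x : s' < x i := max_lt hsx hxi
  have hs'0 : 0 ≤ s' := le_max_right _ _
  have htail : tailSum (fun i => x i + 2 * η) w (s' + 2 * η) = tailSum x w s := by
    simp only [tailSum, add_lt_add_iff_right, s', max_lt_iff, hx, and_true]
  have hF : s' + 2 * η ≤ smoothInverse (tailSum (fun i => x i + 2 * η) w) c η v :=
    le_smoothInverse (antitone_tailSum hw) hη.le ⟨by positivity, by linarith⟩ (htail ▸ hv.le)
  have hc : 0 < c := by linarith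
  rw [div_lt_iff₀ (by positivity)] at hr
  have hr0 : 0 < r := by
    by_contra! hr0
    nlinarith
  nlinarith [mul_le_mul_of_nonneg_left hF hr0.le]

section

variable {M : WeightedMean K I} {C : ℝ≥0∞} {x w : ℕ → ℝ}

theorem WeightedMean.exists_testFunction (hI : I.OrdConnected) (hI0 : IsGLB I 0)
    (hsymm : M.IsSymmetric) (hmono : M.IsMonotone) {n : ℕ} {x w : Fin n → ℝ} (hx : ∀ i, 0 < x i)
    (hw : ∀ i, 0 ≤ w i) {c θ : ℝ} (hc : c ∈ I) (hc0 : 0 < c) (hθ : 0 < θ)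
    (hxc : ∀ i, x i + θ ≤ c) {e : ℝ} (he : 0 < e) :
    ∃ f : ℝ → ℝ, Continuous f ∧ MapsTo f (Ici 0) I ∧ IntegrableOn f (Ici 0) ∧
      (∀ᵐ t ∂volume.restrict (Ioi (0 : ℝ)), M.ExtDefined 0 t f) ∧
      ∫⁻ t in Ioi (0 : ℝ), ENNReal.ofReal (f t) ≤
        (∑ i, ENNReal.ofReal (w i * x i)) + ENNReal.ofReal e ∧
      ∃ η > 0, ∀ s v, 0 ≤ v → v < tailSum x w s → s + η < f v := by
  have hW : 0 ≤ ∑ i, w i := Finset.sum_nonneg fun i _ => hw i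
  obtain ⟨η, hη, hη_lt⟩ := exists_between
    (show 0 < min (θ / 2) (e / (2 * ∑ i, w i + c)) by positivity)
  obtain ⟨hηθ, hηe⟩ := lt_min_iff.mp hη_lt
  rw [lt_div_iff₀' (by positivity)] at hηe
  set F := smoothInverse (tailSum (fun i => x i + 2 * η) w) c η
  have hT := (antitone_tailSum (x := fun i => x i + 2 * η) hw).measurable
  have hF_cont : Continuous F := continuous_smoothInverse hT
  have hF_pos (v : ℝ) : 0 < F v := smoothInverse_pos hT hc0 v
  have hF_le (v : ℝ) : F v ≤ c := smoothInverse_le hT hc0.le v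
  have hF_lintegral : ∫⁻ v in Ioi (0 : ℝ), ENNReal.ofReal (F v) ≤
      (∑ i, ENNReal.ofReal (w i * x i)) + ENNReal.ofReal e :=
    (lintegral_smoothInverse_tailSum_le hw hc0.le hη).trans (by gcongr)
  have hF_int : IntegrableOn F (Ici 0) := by
    rw [integrableOn_Ici_iff_integrableOn_Ioi]
    refine ⟨hF_cont.aestronglyMeasurable, ?_⟩
    rw [hasFiniteIntegral_iff_ofReal (.of_forall fun v => (hF_pos v).le)]
    exact hF_lintegral.trans_lt (by simp [ENNReal.sum_lt_top])
  obtain ⟨r, ⟨hr, hr1⟩, hext⟩ := exists_extDefined hI hI0 hsymm hmono hF_cont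
    (antitone_smoothInverse hT hη.le) hF_pos hF_int hc hF_le
    (show 0 ≤ (c + η) / (c + 2 * η) by positivity)
    ((div_lt_one (by positivity)).mpr (by linarith))
  have hr0 : 0 < r := lt_of_le_of_lt (by positivity) hr
  have hrF (v : ℝ) : r * F v ≤ F v := mul_le_of_le_one_left (hF_pos v).le hr1.le
  refine ⟨fun v => r * F v, by fun_prop, fun v _ => mem_of_pos_of_le hI hI0 hc
    (mul_pos hr0 (hF_pos v)) ((hrF v).trans (hF_le v)), hF_int.const_mul r, hext, ?_, η, hη, ?_⟩
  · exact (lintegral_mono fun v => ENNReal.ofReal_le_ofReal (hrF v)).trans hF_lintegral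
  · exact fun s v => add_lt_mul_smoothInverse hx hw hη (fun i => by linarith [hxc i]) hr

theorem WeightedMean.toFun_le_lower (hsymm : M.IsSymmetric) (hmono : M.IsMonotone) {n : ℕ}
    {x w : Fin n → ℝ} (hx : ∀ i, x i ∈ I) (hw : IsWeight K w) {f : ℝ → ℝ} (hf : Continuous f)
    {t : ℝ} (ht0 : 0 ≤ t) (ht : t ≤ ∑ i, w i) {η : ℝ} (hη : 0 < η)
    (hfx : ∀ s v, 0 ≤ v → v < tailSum x w s → s + η < f v) :
    (M.toFun n x w : EReal) ≤ M.lower 0 t f := by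
  set d := WeightedTuple.normalize x w hx hw
  have hbelow : d.LiesBelow (rescale 0 t f) := by
    refine ⟨η, hη, fun s => ?_⟩
    have hsub : Ico 0 (d.tail s) ⊆ superlevel (rescale 0 t f) (s + η) := fun u hu => by
      refine ⟨⟨hu.1, hu.2.trans_le (d.tail_le_one s)⟩, ?_⟩
      rw [rescale_zero_left]
      refine hfx s (u * t) (mul_nonneg hu.1 ht0) ?_
      have hlt := hu.2
      rw [WeightedTuple.tail_normalize, lt_inv_mul_iff₀ hw.2] at hlt
      exact (mul_comm u t ▸ mul_le_mul_of_nonneg_right ht hu.1).trans_lt hlt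
    simpa using measure_mono (μ := volume) hsub
  have hcont : ContinuousOn (rescale 0 t f) (Icc 0 1) := by
    rw [rescale_zero_left]
    fun_prop
  rw [← M.val_normalize x w hx hw]
  exact (le_iSup₂_of_le d hbelow le_rfl).trans (innerMean_le_lower hsymm hmono hcont)

theorem tailSum_castLE_le {n : ℕ} {x w : Fin n → ℝ} (hw : ∀ i, 0 ≤ w i) {m : ℕ} (hmn : m ≤ n)
    (s : ℝ) :
    tailSum (x ∘ Fin.castLE hmn) (w ∘ Fin.castLE hmn) s ≤ tailSum x w s := by
  refine (Finset.sum_map _ (Fin.castLEEmb hmn) w).symm.trans_le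
    (Finset.sum_le_sum_of_subset_of_nonneg ?_ fun i _ _ => hw i)
  intro i hi
  obtain ⟨j, hj, rfl⟩ := Finset.mem_map.mp hi
  simpa using hj

theorem sum_mul_le_setLIntegral_Ioi {W : ℕ → ℝ} (hW : Monotone W) (hW0 : 0 ≤ W 0)
    {G : ℝ → ℝ≥0∞} {a : ℕ → ℝ≥0∞} {N : ℕ}
    (h : ∀ n < N, ∀ t ∈ Ioc (W n) (W (n + 1)), a n ≤ G t) :
    ∑ n ∈ Finset.range N, ENNReal.ofReal (W (n + 1) - W n) * a n ≤ ∫⁻ t in Ioi 0, G t :=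
  calc ∑ n ∈ Finset.range N, ENNReal.ofReal (W (n + 1) - W n) * a n
      ≤ ∑ n ∈ Finset.range N, ∫⁻ t in Ioc (W n) (W (n + 1)), G t := by
        refine Finset.sum_le_sum fun n hn => ?_
        rw [mul_comm, ← Real.volume_Ioc, ← setLIntegral_const]
        exact setLIntegral_mono' measurableSet_Ioc (h n (Finset.mem_range.mp hn))
    _ = ∫⁻ t in ⋃ n ∈ Finset.range N, Ioc (W n) (W (n + 1)), G t :=
        (lintegral_biUnion_finset (hW.pairwise_disjoint_on_Ioc_succ.set_pairwise _)
          (fun _ _ => measurableSet_Ioc) _).symm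
    _ ≤ ∫⁻ t in Ioi 0, G t := lintegral_mono_set <| iUnion₂_subset fun n _ t ht =>
        (hW0.trans (hW n.zero_le)).trans_lt ht.1

theorem WeightedMean.sum_prefixMean_le_lintegral_lower (hsymm : M.IsSymmetric)
    (hmono : M.IsMonotone) (hx : ∀ n, x n ∈ I) (hw : ∀ n, w n ∈ K ∧ 0 < w n) {N : ℕ} {f : ℝ → ℝ}
    (hf : Continuous f) {η : ℝ} (hη : 0 < η)
    (hfx : ∀ s v, 0 ≤ v → v < tailSum (fun i : Fin N => x i) (fun i => w i) s → s + η < f v) :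
    ∑ n ∈ Finset.range N, ENNReal.ofReal (w n * M.prefixMean x w n) ≤
      ∫⁻ t in Ioi (0 : ℝ), (M.lower 0 t f).toENNReal := by
  let W (n : ℕ) : ℝ := ∑ i ∈ Finset.range n, w i
  have hW : Monotone W := monotone_nat_of_le_succ fun n => by
    simp only [W, Finset.sum_range_succ]
    linarith [(hw n).2]
  have hWsub (n : ℕ) : W (n + 1) - W n = w n := by simp [W, Finset.sum_range_succ]
  have hmean (n) (hn : n < N) (t) (ht : t ∈ Ioc (W n) (W (n + 1))) :
      ENNReal.ofReal (M.prefixMean x w n) ≤ (M.lower 0 t f).toENNReal := by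
    have ht0 : 0 ≤ t := (hW n.zero_le).trans ht.1.le
    rw [← EReal.real_coe_toENNReal]
    refine EReal.toENNReal_le_toENNReal (M.toFun_le_lower hsymm hmono (fun i => hx i)
      (isWeight_of_pos fun i => hw i) hf ht0 (ht.2.trans_eq (Finset.sum_range w)) hη
      fun s v hv0 hv => hfx s v hv0 (hv.trans_le ?_))
    exact tailSum_castLE_le (x := fun i : Fin N => x i) (fun i => (hw i).2.le)
      (Nat.succ_le_of_lt hn) s
  simpa only [hWsub, ← ENNReal.ofReal_mul (hw _).2.le] using
    sum_mul_le_setLIntegral_Ioi hW le_rfl hmean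

/-- The integral Hardy inequality of `M⁰` holds with the constant `C`. -/
def WeightedMean.IsIntegralHardyBound (M : WeightedMean K I) (C : ℝ≥0∞) : Prop :=
  ∀ f : ℝ → ℝ, MapsTo f (Ici 0) I → IntegrableOn f (Ici 0) →
    (∀ᵐ t ∂(volume.restrict (Ioi (0 : ℝ))), M.ExtDefined 0 t f) →
    ∫⁻ t in Ioi (0 : ℝ), (M.ext 0 t f).toENNReal ≤ C * ∫⁻ t in Ioi (0 : ℝ), ENNReal.ofReal (f t)

namespace WeightedMean.IsIntegralHardyBound

theorem sum_prefixMean_le_of_add_le (hC : M.IsIntegralHardyBound C) (hC' : C ≠ ∞)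
    (hI : I.OrdConnected) (hI0 : IsGLB I 0) (hsymm : M.IsSymmetric) (hmono : M.IsMonotone)
    (hx : ∀ n, x n ∈ I ∧ 0 < x n) (hw : ∀ n, w n ∈ K ∧ 0 < w n) {N : ℕ} {c θ : ℝ} (hc : c ∈ I)
    (hc0 : 0 < c) (hθ : 0 < θ) (hxc : ∀ n < N, x n + θ ≤ c) :
    ∑ n ∈ Finset.range N, ENNReal.ofReal (w n * M.prefixMean x w n) ≤
      C * ∑ n ∈ Finset.range N, ENNReal.ofReal (w n * x n) := by
  refine le_of_forall_le_add_mul_one_div hC' fun k => ?_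
  obtain ⟨f, hf, hfI, hf_int, hf_ext, hf_le, η, hη, hfx⟩ :=
    M.exists_testFunction hI hI0 hsymm hmono (x := fun i : Fin N => x i)
      (w := fun i : Fin N => w i) (fun i => (hx i).2) (fun i => (hw i).2.le) hc hc0 hθ
      (fun i => hxc i i.2) (show (0 : ℝ) < 1 / ((k : ℝ) + 1) by positivity)
  calc ∑ n ∈ Finset.range N, ENNReal.ofReal (w n * M.prefixMean x w n)
      ≤ ∫⁻ t in Ioi (0 : ℝ), (M.ext 0 t f).toENNReal :=
        M.sum_prefixMean_le_lintegral_lower hsymm hmono (fun n => (hx n).1) hw hf hη hfx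
    _ ≤ C * ∫⁻ t in Ioi (0 : ℝ), ENNReal.ofReal (f t) := hC f hfI hf_int hf_ext
    _ ≤ C * ((∑ n ∈ Finset.range N, ENNReal.ofReal (w n * x n)) +
          ENNReal.ofReal (1 / ((k : ℝ) + 1))) := by
        rw [Finset.sum_range]
        gcongr
    _ = _ := mul_add _ _ _

theorem sum_prefixMean_le_of_not_isGreatest (hC : M.IsIntegralHardyBound C) (hC' : C ≠ ∞)
    (hI : I.OrdConnected) (hI0 : IsGLB I 0) (hsymm : M.IsSymmetric) (hmono : M.IsMonotone)
    (hmax : ∀ b, ¬IsGreatest I b) (hx : ∀ n, x n ∈ I ∧ 0 < x n)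
    (hw : ∀ n, w n ∈ K ∧ 0 < w n) (N : ℕ) :
    ∑ n ∈ Finset.range N, ENNReal.ofReal (w n * M.prefixMean x w n) ≤
      C * ∑ n ∈ Finset.range N, ENNReal.ofReal (w n * x n) := by
  obtain ⟨j, -, hj⟩ := (Finset.range (N + 1)).exists_max_image x Finset.nonempty_range_add_one
  obtain ⟨c, hc, hjc⟩ : ∃ c ∈ I, x j < c := by
    by_contra! hcon
    exact hmax (x j) ⟨(hx j).1, hcon⟩
  refine hC.sum_prefixMean_le_of_add_le hC' hI hI0 hsymm hmono hx hw hc ((hx j).2.trans hjc)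
    (sub_pos.mpr hjc) fun n hn => ?_
  linarith [hj n (Finset.mem_range.mpr (by omega))]

theorem sum_prefixMean_le_of_isGreatest (hC : M.IsIntegralHardyBound C) (hC' : C ≠ ∞)
    (hI : I.OrdConnected) (hI0 : IsGLB I 0) (hsymm : M.IsSymmetric) (hmono : M.IsMonotone)
    (hcont : M.IsContinuousInEntries) {b : ℝ} (hb : IsGreatest I b)
    (hx : ∀ n, x n ∈ I ∧ 0 < x n) (hw : ∀ n, w n ∈ K ∧ 0 < w n) (N : ℕ) :
    ∑ n ∈ Finset.range N, ENNReal.ofReal (w n * M.prefixMean x w n) ≤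
      C * ∑ n ∈ Finset.range N, ENNReal.ofReal (w n * x n) := by
  have hb0 : 0 < b := (hx 0).2.trans_le (hb.2 (hx 0).1)
  obtain ⟨β, -, hβ, hβ_lim⟩ := exists_seq_strictMono_tendsto' hb0
  let X (k n : ℕ) : ℝ := min (x n) (β k)
  have hX (k n : ℕ) : X k n ∈ I ∧ 0 < X k n := by
    have hpos : 0 < X k n := lt_min (hx n).2 (hβ k).1
    exact ⟨mem_of_pos_of_le hI hI0 (hx n).1 hpos (min_le_left _ _), hpos⟩
  have hX_lim (n : ℕ) : Filter.Tendsto (X · n) Filter.atTop (nhds (x n)) := by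
    simpa only [min_eq_left (hb.2 (hx n).1)] using (tendsto_const_nhds (x := x n)).min hβ_lim
  have hX_le (k : ℕ) : ∑ n ∈ Finset.range N, ENNReal.ofReal (w n * M.prefixMean (X k) w n) ≤
      C * ∑ n ∈ Finset.range N, ENNReal.ofReal (w n * x n) := by
    refine (hC.sum_prefixMean_le_of_add_le hC' hI hI0 hsymm hmono (hX k) hw hb.1 hb0
      (sub_pos.mpr (hβ k).2) fun n _ => by linarith [min_le_right (x n) (β k)]).trans ?_
    gcongr with n
    · exact (hw n).2.le
    · exact min_le_left _ _
  refine le_of_tendsto' (x := Filter.atTop) (tendsto_finsetSum _ fun n _ => ?_) hX_le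
  refine ENNReal.tendsto_ofReal (.const_mul _ ?_)
  exact (hcont (n + 1) _ (isWeight_of_pos fun i => hw i) _ fun i => (hx i).1).tendsto.comp
    (tendsto_nhdsWithin_iff.mpr ⟨tendsto_pi_nhds.mpr fun i => hX_lim i,
      .of_forall fun k i => (hX k i).1⟩)

end WeightedMean.IsIntegralHardyBound

end

theorem hardyConst_le_integralHardyConstOn_ext {M : WeightedMean K I} (hI : I.OrdConnected)
    (hI0 : IsGLB I 0) (hsymm : M.IsSymmetric) (hmono : M.IsMonotone)
    (hmax : ∀ b : ℝ, IsGreatest I b → M.IsContinuousInEntries) :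
    M.hardyConst ≤ integralHardyConstOn I M.ExtDefined M.ext := by
  refine le_sInf fun C (hC : M.IsIntegralHardyBound C) => ?_
  by_cases hC' : C = ∞
  · exact hC' ▸ le_top
  refine sInf_le fun x w hx hw => ?_
  rw [ENNReal.tsum_eq_iSup_nat]
  refine iSup_le fun N => le_trans ?_ (mul_le_mul_right (ENNReal.sum_le_tsum (Finset.range N)) C)
  by_cases hb : ∃ b, IsGreatest I b
  · obtain ⟨b, hb⟩ := hb
    exact hC.sum_prefixMean_le_of_isGreatest hC' hI hI0 hsymm hmono (hmax b hb) hb hx hw N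
  · push Not at hb
    exact hC.sum_prefixMean_le_of_not_isGreatest hC' hI hI0 hsymm hmono hb hx hw N

end HardyMeans

theorem mainTheorem1 (K : Subfield ℝ) (I : Set ℝ) (hI : I.OrdConnected) (hI0 : IsGLB I 0)
    (M : HardyMeans.WeightedMean K I) (hsymm : M.IsSymmetric) (hmono : M.IsMonotone)
    (hmax : ∀ b : ℝ, IsGreatest I b → M.IsContinuousInEntries) :
    HardyMeans.integralHardyConst I M.lower = M.hardyConst ∧
    HardyMeans.integralHardyConst I M.upper = M.hardyConst ∧
    HardyMeans.integralHardyConstOn I M.ExtDefined M.ext = M.hardyConst := by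
  have hHc_ext := HardyMeans.hardyConst_le_integralHardyConstOn_ext hI hI0 hsymm hmono hmax
  have hext_lower := HardyMeans.integralHardyConstOn_ext_le_lower (M := M)
  have hlower_upper := HardyMeans.integralHardyConst_lower_le_upper (M := M) hI
  have hupper_Hc := HardyMeans.integralHardyConst_upper_le_hardyConst hI hI0 hsymm hmono
  exact ⟨le_antisymm (hlower_upper.trans hupper_Hc) (hHc_ext.trans hext_lower),
    le_antisymm hupper_Hc ((hHc_ext.trans hext_lower).trans hlower_upper),
    le_antisymm ((hext_lower.trans hlower_upper).trans hupper_Hc) hHc_ext⟩
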